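/- Let $\Omega\subset\mathbb R^3$ be a nonempty bounded open set with smooth boundary. Let $U\supset\partial\Omega$ be an open neighborhood in which every point has a unique nearest point on $\partial\Omega$, and in which the nearest point map $\pi$ and the signed distance $\rho$ to $\partial\Omega$ ($\rho<0$ in $\Omega$) are smooth; let $n=\nabla\rho|_{\partial\Omega}$ be the outward unit normal. Let $r_0>0$ be such that $V_{r_0}=\{x:-2r_0\le\rho(x)\le 0\}\subset U$. Let $\star$ be the Hodge star of Euclidean $\mathbb R^3$ and $d^*=\star d\star$ the formal adjoint of $d$ on 2-forms, and let $\star_2$ be the Hodge star of $\partial\Omega$, oriented by $dS=i_n\,dV$. For a form $\theta$ defined on $\overline\Omega$, let $\theta|_{\partial\Omega}$ denote its pull-back to $\partial\Omega$ under the inclusion. Let $\gamma_0$ be a smooth 1-form on $\partial\Omega$, let $\gamma=\pi^*\gamma_0$, and let $\psi\in C^\infty_c(-2r_0,2r_0)$ be real valued with $\psi(r)=1$ for $|r|\le r_0$. For $\lambda>0$ put $$E_\lambda(r)=\int_{-\infty}^r e^{s/\lambda}\psi(s)\,ds,\qquad \beta_\lambda=d\bigl(E_\lambda(\rho)\,\gamma\bigr).$$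 Then: 1. There is a compact set $K\subset V_{r_0}\cap\{\rho>-2r_0\}$ such that, for all $\lambda>0$, $\beta_\lambda$ vanishes on $\overline\Omega\setminus K$, where outside $U$ the form $\beta_\lambda$ is extended by $0$ to $\overline\Omega$. The extended form is smooth on an open neighborhood of $\overline\Omega$ (namely $\Omega\cup U$). 2. For every $\lambda>0$, $$\beta_\lambda=e^{\rho/\lambda}\psi(\rho)\,d\rho\wedge\gamma+E_\lambda(\rho)\,d\gamma\ \text{ in } U,\qquad d\beta_\lambda=0\ \text{ in }\overline\Omega,\qquad (\star\beta_\lambda)|_{\partial\Omega}=\star_2\gamma_0 .$$ 3. There is a constant $C$, independent of $\lambda$, such that $\|\beta_\lambda\|_{L^2(\Omega)}\le C\sqrt\lambda$ for all $\lambda>0$. For every $\lambda_0>0$ there is a constant $C$ such that $$\bigl\|(dd^*+\lambda^{-2})\beta_\lambda\bigr\|_{L^2(\Omega)}\le \frac{C}{\sqrt\lambda}\qquad\text{for all } 0<\lambda\le\lambda_0 .$$ 4. For every $s\in\mathbb R$ (and every choice of finite smooth atlas and subordinate partition of unity used to define the norm of $H^s(\partial\Omega)$) there is a constant $C_s$,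 independent of $\lambda$, such that $\|\beta_\lambda|_{\partial\Omega}\|_{H^s(\partial\Omega)}\le C_s\lambda$ for all $\lambda>0$. -/

import Mathlib

open Set MeasureTheory
open scoped ContDiff ENNReal FourierTransform

noncomputable section

namespace London

/-- Euclidean three-space. -/
abbrev E3 := EuclideanSpace ℝ (Fin 3)

/-- The Euclidean plane, the parameter space of local charts of a surface. -/
abbrev E2 := EuclideanSpace ℝ (Fin 2)

/-- Alternating `k`-linear forms on `ℝ³`; a differential `k`-form is a map `E3 → Form k`. -/
abbrev Form (k : ℕ) := E3 [⋀^Fin k]→L[ℝ] ℝ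

/-- The standard basis vector `e_i` of `ℝ³`. -/
def e3 (i : Fin 3) : E3 := EuclideanSpace.single i 1

/-! ### Domains with smooth boundary, nearest point map, signed distance -/

/-- Near each boundary point `Ω` is a strict sublevel set `{φ < 0}` of a smooth function
without critical points (so that `∂Ω` is there the smooth surface `{φ = 0}`). -/
def HasSmoothBoundary (Ω : Set E3) : Prop :=
  ∀ p ∈ frontier Ω, ∃ W : Set E3, IsOpen W ∧ p ∈ W ∧ ∃ φ : E3 → ℝ,
    ContDiffOn ℝ ∞ φ W ∧ (∀ x ∈ W, fderiv ℝ φ x ≠ 0) ∧ ∀ x ∈ W, (x ∈ Ω ↔ φ x < 0)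

/-- `p` is a point of `∂Ω` nearest to `x`. -/
def IsNearest (Ω : Set E3) (x p : E3) : Prop :=
  p ∈ frontier Ω ∧ ∀ q ∈ frontier Ω, dist x p ≤ dist x q

/-- The nearest point map `π` (some nearest point, where there are several). -/
def nearestPoint (Ω : Set E3) (x : E3) : E3 := Classical.epsilon (IsNearest Ω x)

open Classical in
/-- The signed distance `ρ` to `∂Ω`, negative in `Ω`. -/
def signedDist (Ω : Set E3) (x : E3) : ℝ :=
  if x ∈ Ω then -dist x (nearestPoint Ω x) else dist x (nearestPoint Ω x)

/-- `U` is an open neighbourhood of `∂Ω` in which the nearest point map is single valued, and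
in which it and the signed distance are smooth. -/
structure IsTubularNhd (Ω U : Set E3) : Prop where
  isOpen : IsOpen U
  frontier_subset : frontier Ω ⊆ U
  existsUnique_nearest : ∀ x ∈ U, ∃! p, IsNearest Ω x p
  contDiffOn_nearestPoint : ContDiffOn ℝ ∞ (nearestPoint Ω) U
  contDiffOn_signedDist : ContDiffOn ℝ ∞ (signedDist Ω) U

/-- The one-sided collar `V_{r₀} = {-2 r₀ ≤ ρ ≤ 0}`. -/
def collar (Ω : Set E3) (r₀ : ℝ) : Set E3 :=
  {x | -(2 * r₀) ≤ signedDist Ω x ∧ signedDist Ω x ≤ 0}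

/-! ### Forms on the boundary -/

/-- The outward unit normal of `Ω` at a boundary point, `n = ∇ρ`. -/
def normal (Ω : Set E3) (p : E3) : E3 := gradient (signedDist Ω) p

/-- The tangent plane `T_p ∂Ω = n(p)^⊥`. -/
def tangentPlane (Ω : Set E3) (p : E3) : Submodule ℝ E3 :=
  (Submodule.span ℝ {normal Ω p})ᗮ

/-- Orthogonal projection of `ℝ³` onto `T_p ∂Ω`. -/
def tangentProj (Ω : Set E3) (p : E3) : E3 →L[ℝ] tangentPlane Ω p :=
  (tangentPlane Ω p).orthogonalProjectionOnto

/-- A (not necessarily smooth) 1-form on the surface `∂Ω`. -/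
abbrev BoundaryOneForm (Ω : Set E3) :=
  (p : frontier Ω) → tangentPlane Ω (p : E3) →L[ℝ] ℝ

/-- A (not necessarily smooth) 2-form on the surface `∂Ω`. -/
abbrev BoundaryTwoForm (Ω : Set E3) :=
  (p : frontier Ω) → tangentPlane Ω (p : E3) [⋀^Fin 2]→L[ℝ] ℝ

/-- A 1-form on `∂Ω` is smooth if it is locally the restriction of a smooth 1-form on an
open subset of `ℝ³`. -/
def BoundaryOneForm.IsSmooth {Ω : Set E3} (γ₀ : BoundaryOneForm Ω) : Prop :=
  ∀ p ∈ frontier Ω, ∃ W : Set E3, IsOpen W ∧ p ∈ W ∧ ∃ α : E3 → (E3 →L[ℝ] ℝ),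
    ContDiffOn ℝ ∞ α W ∧
      ∀ q : frontier Ω, (q : E3) ∈ W → ∀ v : tangentPlane Ω (q : E3), α q v = γ₀ q v

open Classical in
/-- The pull-back `γ = π^* γ₀`, i.e. `γ_x(v) = γ₀_{π(x)}(Dπ(x) v)`. Where `π` is differentiable,
`Dπ(x) v` is tangent to `∂Ω` already, so the projection only records its membership in the
tangent plane; `π(x) ∈ ∂Ω` whenever `∂Ω` is compact and nonempty. -/
def pullback (Ω : Set E3) (γ₀ : BoundaryOneForm Ω) (x : E3) : Form 1 :=
  if h : nearestPoint Ω x ∈ frontier Ω then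
    ContinuousAlternatingMap.ofSubsingleton ℝ E3 ℝ (0 : Fin 1)
      (((γ₀ ⟨nearestPoint Ω x, h⟩).comp (tangentProj Ω (nearestPoint Ω x))).comp
        (fderiv ℝ (nearestPoint Ω) x))
  else 0

/-- The restriction (pull-back under the inclusion `∂Ω → ℝ³`) of a 1-form. -/
def restrictOne (Ω : Set E3) (α : E3 → Form 1) : BoundaryOneForm Ω := fun p =>
  ((ContinuousAlternatingMap.ofSubsingleton ℝ E3 ℝ (0 : Fin 1)).symm (α p)).comp
    (tangentPlane Ω (p : E3)).subtypeL

/-- The restriction (pull-back under the inclusion `∂Ω → ℝ³`) of a 2-form. -/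
def restrictTwo (Ω : Set E3) (η : E3 → Form 2) : BoundaryTwoForm Ω := fun p =>
  (η p).compContinuousLinearMap (tangentPlane Ω (p : E3)).subtypeL

/-- The cross product on `ℝ³`. -/
def cross (v w : E3) : E3 := WithLp.toLp 2 (crossProduct v.ofLp w.ofLp)

theorem cross_mem_tangentPlane (Ω : Set E3) (p v : E3) :
    cross v (normal Ω p) ∈ tangentPlane Ω p := by
  rw [tangentPlane, Submodule.mem_orthogonal_singleton_iff_inner_right]
  simp [cross, PiLp.inner_apply, Fin.sum_univ_three, cross_apply]
  ring

/-- The rotation `v ↦ v × n` of the tangent plane; it takes an oriented orthonormal basis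
`(u₁, u₂)`, where `dS = i_n dV`, to `(-u₂, u₁)`. -/
def tangentRot (Ω : Set E3) (p : E3) : tangentPlane Ω p →ₗ[ℝ] tangentPlane Ω p where
  toFun v := ⟨cross v (normal Ω p), cross_mem_tangentPlane Ω p v⟩
  map_add' v w := by
    ext i
    simp [cross]
  map_smul' c v := by
    ext i
    simp [cross]

/-- The Hodge star `⋆₂` of `∂Ω` on 1-forms, for the orientation `dS = i_n dV`: if `(ω₁, ω₂)` is
an oriented orthonormal coframe, then `⋆₂ ω₁ = ω₂` and `⋆₂ ω₂ = -ω₁`. -/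
def starBoundary (Ω : Set E3) (γ₀ : BoundaryOneForm Ω) : BoundaryOneForm Ω := fun p =>
  (γ₀ p).comp (LinearMap.toContinuousLinearMap (tangentRot Ω p))

/-! ### Exterior calculus in `ℝ³` -/

/-- The wedge product `a ∧ η` of a covector and a `k`-form; for `k = 1` it is
`(a ∧ b)(v, w) = a(v) b(w) - a(w) b(v)`. -/
def wedge {k : ℕ} (a : E3 →L[ℝ] ℝ) (η : Form k) : Form (k + 1) :=
  ContinuousAlternatingMap.alternatizeUncurryFin (a.smulRight η)

/-- The component `η(e_{i+1}, e_{i+2})` (cyclic indices) of a 2-form: the coefficient of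
`dx₂∧dx₃`, `dx₃∧dx₁`, `dx₁∧dx₂`, respectively. -/
def twoCoeff (η : Form 2) (i : Fin 3) : ℝ := η ![e3 (i + 1), e3 (i + 2)]

/-- The Hodge star on 2-forms: `dx₂∧dx₃ ↦ dx₁`, `dx₃∧dx₁ ↦ dx₂`, `dx₁∧dx₂ ↦ dx₃`. -/
def star (η : Form 2) : Form 1 :=
  ContinuousAlternatingMap.ofSubsingleton ℝ E3 ℝ (0 : Fin 1)
    (∑ i, twoCoeff η i • (EuclideanSpace.proj i : E3 →L[ℝ] ℝ))

/-- The pointwise Euclidean norm of a 2-form. -/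
def twoNorm (η : Form 2) : ℝ := Real.sqrt (∑ i, twoCoeff η i ^ 2)

/-- The formal adjoint of `d` on 2-forms of `ℝ³`: `d^* = ⋆ d ⋆`. -/
def codiff (η : E3 → Form 2) (x : E3) : Form 1 := star (extDeriv (fun y => star (η y)) x)

/-- The operator `d d^* + λ^{-2}` on 2-forms. -/
def londonOp (lam : ℝ) (η : E3 → Form 2) (x : E3) : Form 2 :=
  extDeriv (codiff η) x + (lam ^ 2)⁻¹ • η x

/-- The `L²(Ω)`-norm of a 2-form. -/
def normL2 (Ω : Set E3) (η : E3 → Form 2) : ℝ≥0∞ :=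
  eLpNorm (fun x => twoNorm (η x)) 2 (volume.restrict Ω)

/-! ### Sobolev norms on the boundary -/

/-- A finite atlas of `∂Ω` by smooth parametrizations, with a subordinate smooth partition
of unity. -/
structure BoundaryAtlas (Ω : Set E3) where
  card : ℕ
  chart : Fin card → OpenPartialHomeomorph E2 (frontier Ω)
  contDiffOn_chart : ∀ j,
    ContDiffOn ℝ ∞ (fun y => (chart j y : E3)) (chart j).source
  injective_fderiv : ∀ j, ∀ y ∈ (chart j).source,
    Function.Injective (fderiv ℝ (fun z => (chart j z : E3)) y)
  cutoff : Fin card → E3 → ℝ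
  contDiff_cutoff : ∀ j, ContDiff ℝ ∞ (cutoff j)
  cutoff_nonneg : ∀ j x, 0 ≤ cutoff j x
  cutoff_support : ∀ j, ∀ p : frontier Ω, (p : E3) ∈ tsupport (cutoff j) → p ∈ (chart j).target
  sum_cutoff : ∀ p ∈ frontier Ω, ∑ j, cutoff j p = 1

open Classical in
/-- The coefficient, with respect to `dy₁∧dy₂`, of the pull-back of `χ_j τ` by the `j`-th
parametrization, extended by zero to the plane. (The partial derivatives of the parametrization
are tangent to `∂Ω` already; the projection only records this.) -/
def BoundaryAtlas.localCoeff {Ω : Set E3} (A : BoundaryAtlas Ω) (τ : BoundaryTwoForm Ω)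
    (j : Fin A.card) (y : E2) : ℂ :=
  if y ∈ (A.chart j).source then
    ((A.cutoff j (A.chart j y) * τ (A.chart j y) (fun i =>
      tangentProj Ω (A.chart j y)
        (fderiv ℝ (fun z => (A.chart j z : E3)) y (EuclideanSpace.single i 1))) : ℝ) : ℂ)
  else 0

/-- The square of the `H^s(ℝ²)`-norm of an integrable function,
`∫ (1 + |ξ|²)^s |û(ξ)|² dξ` with `û(ξ) = ∫ e^{-2πi⟨y,ξ⟩} u(y) dy`. -/
def sobolevSqPlane (s : ℝ) (u : E2 → ℂ) : ℝ≥0∞ :=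
  ∫⁻ ξ, ENNReal.ofReal ((1 + ‖ξ‖ ^ 2) ^ s * ‖𝓕 u ξ‖ ^ 2)

/-- The `H^s(∂Ω)`-norm, `s ∈ ℝ`, of a continuous 2-form on `∂Ω`, computed in an atlas. -/
def BoundaryAtlas.sobolevNorm {Ω : Set E3} (A : BoundaryAtlas Ω) (s : ℝ)
    (τ : BoundaryTwoForm Ω) : ℝ≥0∞ :=
  (∑ j, sobolevSqPlane s (A.localCoeff τ j)) ^ (1 / 2 : ℝ)

/-! ### The form `β_λ` -/

/-- `E_λ(r) = ∫_{-∞}^r e^{s/λ} ψ(s) ds`. -/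
def expPrimitive (ψ : ℝ → ℝ) (lam r : ℝ) : ℝ :=
  ∫ s in Set.Iic r, Real.exp (s / lam) * ψ s

/-- `β_λ = d(E_λ(ρ) π^* γ₀)`. If `ψ` is supported in `(-2 r₀, 2 r₀)`, the form in brackets
vanishes at all points of `Ω` with `ρ ≤ -2 r₀`, so that in `Ω` this is
automatically the extension by zero from the collar. -/
def beta (Ω : Set E3) (ψ : ℝ → ℝ) (γ₀ : BoundaryOneForm Ω) (lam : ℝ) (x : E3) : Form 2 :=
  extDeriv (fun y => expPrimitive ψ lam (signedDist Ω y) • pullback Ω γ₀ y) x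

end London

end

/-!
Write `β = a(ρ) dρ ∧ γ + f(ρ) dγ` with `a(r) = e^{r/λ} ψ(r)` and `f = E_λ`, `f' = a`.

The geometry of the collar enters through `x - π(x) = ρ(x) ∇ρ(x)` (`nearestPoint_eq`), which follows
from differentiating `ρ² = |x - π(x)|²` and from the minimality of `|x - π(x)|`. It gives `|∇ρ| = 1`
and, on `∂Ω`, `Dπ = 1 - n ⊗ n`. Since `γ = π^*γ₀` is locally the pull-back under `π` of a smooth
1-form of `ℝ³`, `dγ` is annihilated by `n` on `∂Ω` (`extDeriv_pullback_normal`). So `⋆dγ` has no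
tangential part there, and `(⋆β)|_{∂Ω}` is the restriction of `⋆(dρ ∧ γ)`, that is `v ↦ γ₀(v × n)`.

In `dd^*β` the only term with two derivatives on `a` is `a''(ρ) dρ ∧ ⋆(dρ ∧ ⋆(dρ ∧ γ))`, which is
`-a''(ρ) dρ ∧ γ` because `|dρ| = 1` (`wedge_star_wedge_star_wedge`). Against `λ^{-2} β` the terms of
order `λ^{-2} e^{ρ/λ}` cancel, and `O(λ^{-1} e^{ρ/λ})` is left (`exists_londonOp_eq`). Both `L²`
estimates then reduce to `‖e^{ρ/λ}‖_{L²} = O(√λ)` on the compact inner collar (`exists_normL2_le`).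
This follows from `vol {-t ≤ ρ ≤ 0} = O(t)`, which is proved by using `ρ` as a local coordinate.

Finally `dρ` vanishes on tangent vectors of `∂Ω`, so `β|_{∂Ω} = E_λ(0) dγ|_{∂Ω}` with
`|E_λ(0)| ≤ M λ`, and the restriction of the fixed smooth form `dγ` has finite `H^s`-norm.
-/

noncomputable section

namespace London

/-! ### Exterior algebra of `ℝ³` -/

/-- The coefficient `twoCoeff` as a continuous linear functional. -/
def twoCoeffCLM (i : Fin 3) : Form 2 →L[ℝ] ℝ :=
  ContinuousAlternatingMap.apply ℝ E3 ℝ ![e3 (i + 1), e3 (i + 2)]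

theorem twoCoeffCLM_apply (i : Fin 3) (η : Form 2) : twoCoeffCLM i η = twoCoeff η i := rfl

/-- The Hodge star on 2-forms as a continuous linear map. -/
def starCLM : Form 2 →L[ℝ] Form 1 :=
  ((ContinuousAlternatingMap.ofSubsingletonLIE (𝕜 := ℝ) (E := E3) (F := ℝ) (0 : Fin 1) :
    (E3 →L[ℝ] ℝ) ≃ₗᵢ[ℝ] Form 1).toContinuousLinearEquiv : (E3 →L[ℝ] ℝ) →L[ℝ] Form 1) ∘L
    ∑ i, (twoCoeffCLM i).smulRight (EuclideanSpace.proj i : E3 →L[ℝ] ℝ)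

theorem starCLM_apply (η : Form 2) : starCLM η = star η := by
  ext v
  simp [starCLM, star, twoCoeffCLM_apply]

theorem star_apply (η : Form 2) (v : Fin 1 → E3) :
    star η v = ∑ i, twoCoeff η i * v 0 i := by
  simp [star]

theorem wedge_one_apply (a : E3 →L[ℝ] ℝ) (g : Form 1) (v : Fin 2 → E3) :
    wedge a g v = a (v 0) * g (fun _ => v 1) - a (v 1) * g (fun _ => v 0) := by
  simp only [wedge, ContinuousAlternatingMap.alternatizeUncurryFin_apply]
  have h0 : Fin.removeNth 0 v = fun _ : Fin 1 => v 1 := by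
    ext i; fin_cases i; rfl
  have h1 : Fin.removeNth 1 v = fun _ : Fin 1 => v 0 := by
    ext i; fin_cases i; rfl
  simp [h0, h1]
  ring

theorem sum_smul_e3 (v : E3) : ∑ i, v i • e3 i = v := by
  ext j
  fin_cases j <;> simp [e3, Fin.sum_univ_three]

theorem form_one_apply (g : Form 1) (v : E3) :
    g (fun _ => v) = ∑ i, v i * g (fun _ => e3 i) := by
  obtain ⟨f, rfl⟩ := (ContinuousAlternatingMap.ofSubsingleton ℝ E3 ℝ (0 : Fin 1)).surjective g
  simp only [ContinuousAlternatingMap.ofSubsingleton_apply_apply]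
  conv_lhs => rw [← sum_smul_e3 v]
  simp

/-- A 2-form on `ℝ³` acts as the inner product of its coefficient vector with the cross
product. -/
theorem form_two_apply (η : Form 2) (v : Fin 2 → E3) :
    η v = twoCoeff η 0 * (v 0 1 * v 1 2 - v 0 2 * v 1 1) +
      twoCoeff η 1 * (v 0 2 * v 1 0 - v 0 0 * v 1 2) +
      twoCoeff η 2 * (v 0 0 * v 1 1 - v 0 1 * v 1 0) := by
  have key : ∀ u : E3, u = u 0 • e3 0 + u 1 • e3 1 + u 2 • e3 2 := fun u => by
    rw [← Fin.sum_univ_three (fun i => u i • e3 i), sum_smul_e3]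
  have hswap : ∀ a b : E3, η ![a, b] = -η ![b, a] := by
    intro a b
    have h : η (![b, a] ∘ Equiv.swap 0 1) = -η ![b, a] :=
      η.map_swap ![b, a] (i := 0) (j := 1) (by decide)
    rw [← h]
    congr 1
    ext i
    fin_cases i <;> rfl
  have hself : ∀ a : E3, η ![a, a] = 0 := fun a =>
    η.map_eq_zero_of_eq ![a, a] (i := 0) (j := 1) rfl (by decide)
  have hadd0 : ∀ a a' b : E3, η ![a + a', b] = η ![a, b] + η ![a', b] := by
    intro a a' b
    exact η.map_vecCons_add ![b] a a'
  have hsmul0 : ∀ (c : ℝ) (a b : E3), η ![c • a, b] = c * η ![a, b] := by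
    intro c a b
    exact η.map_vecCons_smul ![b] c a
  have hadd1 : ∀ a b b' : E3, η ![a, b + b'] = η ![a, b] + η ![a, b'] := by
    intro a b b'
    rw [hswap, hadd0, hswap a b, hswap a b']; ring
  have hsmul1 : ∀ (c : ℝ) (a b : E3), η ![a, c • b] = c * η ![a, b] := by
    intro c a b
    rw [hswap, hsmul0, hswap a b]; ring
  have hv : v = ![v 0, v 1] := by ext i; fin_cases i <;> rfl
  conv_lhs => rw [hv, key (v 0), key (v 1)]
  simp only [hadd0, hadd1, hsmul0, hsmul1, hself, twoCoeff]
  rw [hswap (e3 1) (e3 0), hswap (e3 2) (e3 1), hswap (e3 0) (e3 2)]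
  simp
  ring

theorem form_two_ext {η θ : Form 2} (h : ∀ i, twoCoeff η i = twoCoeff θ i) : η = θ := by
  ext v
  rw [form_two_apply η, form_two_apply θ, h, h, h]

theorem e3_apply (i j : Fin 3) : e3 i j = if j = i then 1 else 0 := by
  simp [e3]

theorem star_e3 (η : Form 2) (i : Fin 3) : star η (fun _ => e3 i) = twoCoeff η i := by
  simp [star_apply, e3_apply]

theorem twoCoeff_wedge (a : E3 →L[ℝ] ℝ) (g : Form 1) (i : Fin 3) :
    twoCoeff (wedge a g) i = a (e3 (i + 1)) * g (fun _ => e3 (i + 2)) -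
      a (e3 (i + 2)) * g (fun _ => e3 (i + 1)) := by
  simp [twoCoeff, wedge_one_apply]

/-- Three-fold exterior multiplication by a unit covector `a`, with Hodge stars in between, is
`-1` on multiples of `a`: this is `n × (n × (n × g)) = -n × g`. -/
theorem wedge_star_wedge_star_wedge {a : E3 →L[ℝ] ℝ} (ha : ∑ i, a (e3 i) ^ 2 = 1) (g : Form 1) :
    wedge a (star (wedge a (star (wedge a g)))) = -wedge a g := by
  apply form_two_ext
  intro i
  have hneg : twoCoeff (-wedge a g) i = - twoCoeff (wedge a g) i := rfl
  rw [hneg]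
  simp only [twoCoeff_wedge, star_e3]
  rw [Fin.sum_univ_three] at ha
  fin_cases i
  · simp
    linear_combination (-(a (e3 1)) * g (fun _ => e3 2) + a (e3 2) * g (fun _ => e3 1)) * ha
  · simp
    linear_combination (-(a (e3 2)) * g (fun _ => e3 0) + a (e3 0) * g (fun _ => e3 2)) * ha
  · simp
    linear_combination (-(a (e3 0)) * g (fun _ => e3 1) + a (e3 1) * g (fun _ => e3 0)) * ha

theorem cross_apply_coord (v w : E3) : cross v w 0 = v 1 * w 2 - v 2 * w 1 ∧
    cross v w 1 = v 2 * w 0 - v 0 * w 2 ∧ cross v w 2 = v 0 * w 1 - v 1 * w 0 := by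
  simp [cross, cross_apply]

/-- With `a = ⟨n, ·⟩`, this is `(n × g) · v = g · (v × n)`. -/
theorem star_wedge_apply {a : E3 →L[ℝ] ℝ} {n : E3} (ha : ∀ i, a (e3 i) = n i) (g : Form 1)
    (v : E3) : star (wedge a g) (fun _ => v) = g (fun _ => cross v n) := by
  rw [star_apply, form_one_apply]
  simp only [twoCoeff_wedge, Fin.sum_univ_three, ha]
  obtain ⟨h0, h1, h2⟩ := cross_apply_coord v n
  rw [h0, h1, h2]
  simp
  ring

/-- If a 2-form is annihilated by a unit vector `n`, its Hodge star is a multiple of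
`⟨n, ·⟩`. -/
theorem star_apply_eq_zero {η : Form 2} {n v : E3} (hη : ∀ w, η ![n, w] = 0)
    (hn : ∑ i, n i ^ 2 = 1) (hv : ∑ i, n i * v i = 0) : star η (fun _ => v) = 0 := by
  have h0 := hη (e3 0)
  have h1 := hη (e3 1)
  have h2 := hη (e3 2)
  rw [form_two_apply] at h0 h1 h2
  simp [e3_apply] at h0 h1 h2
  rw [star_apply]
  simp only [Fin.sum_univ_three] at *
  -- `(c·v)(n·n) - (c·n)(n·v) = (c × n)·(v × n)`, where `c` is the coefficient vector of `η` and
  -- `h0`, `h1`, `h2` say that `c × n = 0`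
  linear_combination (-(twoCoeff η 0 * v 0 + twoCoeff η 1 * v 1 + twoCoeff η 2 * v 2)) * hn +
    (twoCoeff η 0 * n 0 + twoCoeff η 1 * n 1 + twoCoeff η 2 * n 2) * hv
    + (v 1 * n 2 - v 2 * n 1) * h0 + (v 2 * n 0 - v 0 * n 2) * h1 + (v 0 * n 1 - v 1 * n 0) * h2

theorem norm_e3 (i : Fin 3) : ‖e3 i‖ = 1 := by simp [e3]

theorem twoNorm_le (η : Form 2) : twoNorm η ≤ 2 * ‖η‖ := by
  have h : ∀ i, |twoCoeff η i| ≤ ‖η‖ := by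
    intro i
    have := η.le_opNorm ![e3 (i + 1), e3 (i + 2)]
    simpa [Fin.prod_univ_two, norm_e3, twoCoeff] using this
  have h2 : ∀ i, twoCoeff η i ^ 2 ≤ ‖η‖ ^ 2 := fun i => by
    rw [← sq_abs]; exact pow_le_pow_left₀ (abs_nonneg _) (h i) 2
  apply Real.sqrt_le_iff.2 ⟨by positivity, ?_⟩
  rw [Fin.sum_univ_three]
  nlinarith [h2 0, h2 1, h2 2, sq_nonneg ‖η‖]

/-! ### Exterior derivative of smooth multiples -/

theorem extDeriv_zero {k : ℕ} : extDeriv (fun _ : E3 => (0 : Form k)) = fun _ => 0 := by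
  ext y v
  simp [extDeriv, ContinuousAlternatingMap.alternatizeUncurryFin_apply]

/-- Leibniz rule `d(g θ) = dg ∧ θ + g dθ`. -/
theorem extDeriv_smul_fun {k : ℕ} {g : E3 → ℝ} {θ : E3 → Form k} {x : E3}
    (hg : DifferentiableAt ℝ g x) (hθ : DifferentiableAt ℝ θ x) :
    extDeriv (fun y => g y • θ y) x = wedge (fderiv ℝ g x) (θ x) + g x • extDeriv θ x := by
  unfold extDeriv wedge
  rw [fderiv_fun_smul hg hθ, ContinuousAlternatingMap.alternatizeUncurryFin_add,
    ContinuousAlternatingMap.alternatizeUncurryFin_smul]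
  exact add_comm _ _

theorem wedge_smul_left {k : ℕ} (c : ℝ) (a : E3 →L[ℝ] ℝ) (η : Form k) :
    wedge (c • a) η = c • wedge a η := by
  unfold wedge
  rw [← ContinuousAlternatingMap.alternatizeUncurryFin_smul]
  congr 1
  ext v w
  simp [mul_assoc]

theorem contDiffOn_extDeriv {k : ℕ} {θ : E3 → Form k} {s : Set E3} (hs : IsOpen s)
    (hθ : ContDiffOn ℝ ∞ θ s) : ContDiffOn ℝ ∞ (extDeriv θ) s :=
  (ContinuousAlternatingMap.alternatizeUncurryFinCLM ℝ E3 ℝ).contDiff.comp_contDiffOn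
    (hθ.fderiv_of_isOpen hs (by simp))

theorem contDiffOn_wedge {k : ℕ} {a : E3 → (E3 →L[ℝ] ℝ)} {η : E3 → Form k} {s : Set E3}
    (ha : ContDiffOn ℝ ∞ a s) (hη : ContDiffOn ℝ ∞ η s) :
    ContDiffOn ℝ ∞ (fun x => wedge (a x) (η x)) s := by
  have h : ContDiffOn ℝ ∞ (fun x => (a x).smulRight (η x)) s := ha.smulRight hη
  have hL : ContDiff ℝ ∞ (ContinuousAlternatingMap.alternatizeUncurryFinCLM (n := k) ℝ E3 ℝ) :=
    ContinuousLinearMap.contDiff _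
  exact hL.comp_contDiffOn h

theorem contDiffOn_star {η : E3 → Form 2} {s : Set E3} (hη : ContDiffOn ℝ ∞ η s) :
    ContDiffOn ℝ ∞ (fun x => star (η x)) s := by
  simp only [← starCLM_apply]
  exact starCLM.contDiff.comp_contDiffOn hη

theorem contDiffOn_codiff {η : E3 → Form 2} {s : Set E3} (hs : IsOpen s)
    (hη : ContDiffOn ℝ ∞ η s) : ContDiffOn ℝ ∞ (codiff η) s :=
  contDiffOn_star (contDiffOn_extDeriv hs (contDiffOn_star hη))

theorem star_add (η θ : Form 2) : star (η + θ) = star η + star θ := by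
  simp only [← starCLM_apply, map_add]

theorem star_smul (c : ℝ) (η : Form 2) : star (c • η) = c • star η := by
  simp only [← starCLM_apply, map_smul]

/-! ### Nearest point map and signed distance -/

section Geometry

variable {Ω U : Set E3}

theorem isCompact_frontier (hb : Bornology.IsBounded Ω) : IsCompact (frontier Ω) :=
  Metric.isCompact_of_isClosed_isBounded isClosed_frontier
    (hb.closure.subset frontier_subset_closure)

theorem frontier_nonempty (hb : Bornology.IsBounded Ω) (hne : Ω.Nonempty) :
    (frontier Ω).Nonempty := by
  rw [nonempty_iff_ne_empty, Ne, ← isClopen_iff_frontier_eq_empty, isClopen_iff]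
  rintro (h | h)
  · exact hne.ne_empty h
  · rw [h] at hb
    exact NormedSpace.unbounded_univ ℝ E3 hb

theorem isNearest_nearestPoint (hb : Bornology.IsBounded Ω) (hne : Ω.Nonempty) (x : E3) :
    IsNearest Ω x (nearestPoint Ω x) := by
  apply Classical.epsilon_spec (p := IsNearest Ω x)
  obtain ⟨p, hp, hmin⟩ := (isCompact_frontier hb).exists_isMinOn (frontier_nonempty hb hne)
    (continuous_const.dist continuous_id : Continuous fun q => dist x q).continuousOn
  exact ⟨p, hp, fun q hq => hmin hq⟩

theorem nearestPoint_mem (hb : Bornology.IsBounded Ω) (hne : Ω.Nonempty) (x : E3) :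
    nearestPoint Ω x ∈ frontier Ω := (isNearest_nearestPoint hb hne x).1

theorem dist_nearestPoint (hb : Bornology.IsBounded Ω) (hne : Ω.Nonempty) (x : E3) :
    dist x (nearestPoint Ω x) = Metric.infDist x (frontier Ω) := by
  obtain ⟨h1, h2⟩ := isNearest_nearestPoint hb hne x
  exact le_antisymm ((Metric.le_infDist ⟨_, h1⟩).2 fun q hq => h2 q hq)
    (Metric.infDist_le_dist_of_mem h1)

theorem nearestPoint_of_mem_frontier (hb : Bornology.IsBounded Ω) (hne : Ω.Nonempty) {p : E3}
    (hp : p ∈ frontier Ω) : nearestPoint Ω p = p := by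
  have h := (isNearest_nearestPoint hb hne p).2 p hp
  rw [dist_self] at h
  exact (dist_le_zero.1 h).symm

theorem signedDist_of_mem (hb : Bornology.IsBounded Ω) (hne : Ω.Nonempty) {x : E3}
    (hx : x ∈ Ω) : signedDist Ω x = -Metric.infDist x (frontier Ω) := by
  rw [signedDist, if_pos hx, dist_nearestPoint hb hne]

theorem signedDist_of_mem_frontier (hb : Bornology.IsBounded Ω) (hne : Ω.Nonempty)
    {p : E3} (hp : p ∈ frontier Ω) : signedDist Ω p = 0 := by
  rw [signedDist, nearestPoint_of_mem_frontier hb hne hp]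
  simp

theorem signedDist_of_mem_closure (hb : Bornology.IsBounded Ω) (hne : Ω.Nonempty) {x : E3}
    (hx : x ∈ closure Ω) : signedDist Ω x = -Metric.infDist x (frontier Ω) := by
  by_cases h : x ∈ Ω
  · exact signedDist_of_mem hb hne h
  · have hp : x ∈ frontier Ω := ⟨hx, fun h' => h (interior_subset h')⟩
    rw [signedDist_of_mem_frontier hb hne hp, Metric.infDist_zero_of_mem hp, neg_zero]

theorem signedDist_sq (x : E3) : signedDist Ω x ^ 2 = ‖x - nearestPoint Ω x‖ ^ 2 := by
  rw [← dist_eq_norm, signedDist]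
  split_ifs <;> ring

theorem mem_frontier_of_signedDist_eq_zero (hb : Bornology.IsBounded Ω) (hne : Ω.Nonempty)
    {x : E3} (hx : signedDist Ω x = 0) : x ∈ frontier Ω := by
  have h := signedDist_sq (Ω := Ω) x
  rw [hx] at h
  have h2 : x - nearestPoint Ω x = 0 := by
    rw [← norm_eq_zero]; exact pow_eq_zero_iff (two_ne_zero) |>.1 (by rw [← h]; norm_num)
  rw [sub_eq_zero.1 h2]
  exact nearestPoint_mem hb hne x

theorem inner_gradient (f : E3 → ℝ) (x v : E3) : inner ℝ (gradient f x) v = fderiv ℝ f x v := by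
  rw [gradient, InnerProductSpace.toDual_symm_apply]

theorem differentiableAt_nearestPoint (hU : IsTubularNhd Ω U) {x : E3} (hx : x ∈ U) :
    DifferentiableAt ℝ (nearestPoint Ω) x :=
  (hU.contDiffOn_nearestPoint.contDiffAt (hU.isOpen.mem_nhds hx)).differentiableAt (by simp)

theorem differentiableAt_signedDist (hU : IsTubularNhd Ω U) {x : E3} (hx : x ∈ U) :
    DifferentiableAt ℝ (signedDist Ω) x :=
  (hU.contDiffOn_signedDist.contDiffAt (hU.isOpen.mem_nhds hx)).differentiableAt (by simp)

theorem contDiffOn_fderiv_signedDist (hU : IsTubularNhd Ω U) :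
    ContDiffOn ℝ ∞ (fderiv ℝ (signedDist Ω)) U :=
  hU.contDiffOn_signedDist.fderiv_of_isOpen hU.isOpen (by simp)

theorem contDiffOn_gradient_signedDist (hU : IsTubularNhd Ω U) :
    ContDiffOn ℝ ∞ (gradient (signedDist Ω)) U :=
  ContDiff.comp_contDiffOn (g := (InnerProductSpace.toDual ℝ E3).symm)
    (InnerProductSpace.toDual ℝ E3).symm.contDiff (contDiffOn_fderiv_signedDist hU)

/-- The displacement `x - π(x)` is orthogonal to the image of `Dπ(x)`, because `y = x` minimizes
`|x - π(y)|²`. -/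
theorem inner_sub_nearestPoint_fderiv (hb : Bornology.IsBounded Ω) (hne : Ω.Nonempty)
    (hU : IsTubularNhd Ω U) {x : E3} (hx : x ∈ U) (v : E3) :
    inner ℝ (x - nearestPoint Ω x) (fderiv ℝ (nearestPoint Ω) x v) = 0 := by
  have hd := ((hasFDerivAt_const x x).sub (differentiableAt_nearestPoint hU hx).hasFDerivAt).norm_sq
  have hmin : IsLocalMin (fun y => ‖x - nearestPoint Ω y‖ ^ 2) x := by
    refine Filter.Eventually.of_forall fun y => ?_
    have := (isNearest_nearestPoint hb hne x).2 _ (nearestPoint_mem hb hne y)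
    rw [dist_eq_norm, dist_eq_norm] at this
    exact pow_le_pow_left₀ (norm_nonneg _) this 2
  have h0 := hmin.hasFDerivAt_eq_zero hd
  have h1 := congrArg (fun L : E3 →L[ℝ] ℝ => L v) h0
  simp only [Pi.sub_apply, zero_sub] at h1
  simp at h1
  rw [inner_sub_left]
  linarith

theorem signedDist_mul_fderiv (hb : Bornology.IsBounded Ω) (hne : Ω.Nonempty)
    (hU : IsTubularNhd Ω U) {x : E3} (hx : x ∈ U) (v : E3) :
    signedDist Ω x * fderiv ℝ (signedDist Ω) x v = inner ℝ (x - nearestPoint Ω x) v := by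
  have hd := ((hasFDerivAt_id x).sub (differentiableAt_nearestPoint hU hx).hasFDerivAt).norm_sq
  have hd2 := (differentiableAt_signedDist hU hx).hasFDerivAt.pow 2
  have heq : (fun y => signedDist Ω y ^ 2) = fun y => ‖y - nearestPoint Ω y‖ ^ 2 :=
    funext fun y => signedDist_sq y
  have h0 := hd2.unique (heq ▸ hd)
  have h1 := congrArg (fun L : E3 →L[ℝ] ℝ => L v) h0
  have h2 := inner_sub_nearestPoint_fderiv hb hne hU hx v
  rw [inner_sub_left] at h2 ⊢
  simp at h1
  linarith

/-- The eikonal identity in vector form, `x - π(x) = ρ(x) ∇ρ(x)`. -/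
theorem nearestPoint_eq (hb : Bornology.IsBounded Ω) (hne : Ω.Nonempty)
    (hU : IsTubularNhd Ω U) {x : E3} (hx : x ∈ U) :
    nearestPoint Ω x = x - signedDist Ω x • gradient (signedDist Ω) x := by
  have : x - nearestPoint Ω x = signedDist Ω x • gradient (signedDist Ω) x := by
    refine ext_inner_right ℝ fun v => ?_
    rw [← signedDist_mul_fderiv hb hne hU hx v, real_inner_smul_left, inner_gradient]
  rw [← this]
  abel

/-- `|∇ρ| = 1`: off `∂Ω` by the eikonal identity, and on `∂Ω` by continuity, since `∂Ω` lies in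
the closure of `Ω`. -/
theorem norm_gradient_signedDist (hΩ : IsOpen Ω) (hb : Bornology.IsBounded Ω) (hne : Ω.Nonempty)
    (hU : IsTubularNhd Ω U) {x : E3} (hx : x ∈ U) : ‖gradient (signedDist Ω) x‖ = 1 := by
  have off : ∀ y ∈ U, signedDist Ω y ≠ 0 → ‖gradient (signedDist Ω) y‖ = 1 := by
    intro y hy h0
    have h1 := signedDist_sq (Ω := Ω) y
    rw [nearestPoint_eq hb hne hU hy, sub_sub_cancel, norm_smul, mul_pow, Real.norm_eq_abs,
      sq_abs] at h1
    have h2 : ‖gradient (signedDist Ω) y‖ ^ 2 = 1 := by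
      have h3 : signedDist Ω y ^ 2 ≠ 0 := pow_ne_zero 2 h0
      field_simp at h1
      exact h1.symm
    nlinarith [norm_nonneg (gradient (signedDist Ω) y)]
  by_cases h0 : signedDist Ω x = 0
  · have hf := mem_frontier_of_signedDist_eq_zero hb hne h0
    have hcl : x ∈ closure Ω := frontier_subset_closure hf
    have := mem_closure_iff_nhdsWithin_neBot.1 hcl
    have hcont : ContinuousAt (fun y => ‖gradient (signedDist Ω) y‖) x :=
      ((contDiffOn_gradient_signedDist hU).continuousOn.continuousAt
        (hU.isOpen.mem_nhds hx)).norm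
    refine tendsto_nhds_unique (hcont.tendsto.mono_left (nhdsWithin_le_nhds (s := Ω))) ?_
    refine tendsto_const_nhds.congr' ?_
    filter_upwards [self_mem_nhdsWithin, nhdsWithin_le_nhds (hU.isOpen.mem_nhds hx)] with y hy hyU
    refine (off y hyU fun hz => ?_).symm
    have := mem_frontier_of_signedDist_eq_zero hb hne hz
    rw [hΩ.frontier_eq] at this
    exact this.2 hy
  · exact off x hx h0

theorem fderiv_signedDist_e3 (x : E3) (i : Fin 3) :
    fderiv ℝ (signedDist Ω) x (e3 i) = gradient (signedDist Ω) x i := by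
  rw [← inner_gradient, e3, EuclideanSpace.inner_single_right]
  simp only [one_mul, conj_trivial]

theorem sum_fderiv_signedDist_sq (hΩ : IsOpen Ω) (hb : Bornology.IsBounded Ω) (hne : Ω.Nonempty)
    (hU : IsTubularNhd Ω U) {x : E3} (hx : x ∈ U) :
    ∑ i, fderiv ℝ (signedDist Ω) x (e3 i) ^ 2 = 1 := by
  have h := norm_gradient_signedDist hΩ hb hne hU hx
  simp only [fderiv_signedDist_e3]
  rw [← EuclideanSpace.real_norm_sq_eq, h, one_pow]

/-- On `∂Ω` the differential of the nearest point map is the projection along the normal. -/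
theorem fderiv_nearestPoint_of_mem_frontier (hb : Bornology.IsBounded Ω) (hne : Ω.Nonempty)
    (hU : IsTubularNhd Ω U) {p : E3} (hp : p ∈ frontier Ω) (v : E3) :
    fderiv ℝ (nearestPoint Ω) p v = v - fderiv ℝ (signedDist Ω) p v • normal Ω p := by
  have hpU := hU.frontier_subset hp
  have heq : nearestPoint Ω =ᶠ[nhds p]
      fun x => x - signedDist Ω x • gradient (signedDist Ω) x := by
    filter_upwards [hU.isOpen.mem_nhds hpU] with x hx using nearestPoint_eq hb hne hU hx
  have hg : DifferentiableAt ℝ (gradient (signedDist Ω)) p :=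
    ((contDiffOn_gradient_signedDist hU).contDiffAt (hU.isOpen.mem_nhds hpU)).differentiableAt
      (by simp)
  have hd : HasFDerivAt (fun x => x - signedDist Ω x • gradient (signedDist Ω) x) _ p :=
    (hasFDerivAt_id p).sub
      ((differentiableAt_signedDist hU hpU).hasFDerivAt.smul hg.hasFDerivAt)
  rw [heq.fderiv_eq, hd.fderiv]
  simp [signedDist_of_mem_frontier hb hne hp, normal]

theorem mem_tangentPlane_iff {p v : E3} :
    v ∈ tangentPlane Ω p ↔ fderiv ℝ (signedDist Ω) p v = 0 := by
  rw [tangentPlane, Submodule.mem_orthogonal_singleton_iff_inner_right, normal, inner_gradient]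

theorem fderiv_signedDist_normal (hΩ : IsOpen Ω) (hb : Bornology.IsBounded Ω) (hne : Ω.Nonempty)
    (hU : IsTubularNhd Ω U) {p : E3} (hp : p ∈ frontier Ω) :
    fderiv ℝ (signedDist Ω) p (normal Ω p) = 1 := by
  rw [← inner_gradient, normal, real_inner_self_eq_norm_sq,
    norm_gradient_signedDist hΩ hb hne hU (hU.frontier_subset hp), one_pow]

/-- A differentiable map with values in `∂Ω` has its differential in the tangent planes. -/
theorem fderiv_mem_tangentPlane {F : Type*} [NormedAddCommGroup F] [NormedSpace ℝ F]
    (hb : Bornology.IsBounded Ω) (hne : Ω.Nonempty)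
    (hU : IsTubularNhd Ω U) {f : F → E3} {x : F} (hf : DifferentiableAt ℝ f x)
    (hmem : ∀ᶠ y in nhds x, f y ∈ frontier Ω) (v : F) :
    fderiv ℝ f x v ∈ tangentPlane Ω (f x) := by
  rw [mem_tangentPlane_iff]
  have hx : f x ∈ frontier Ω := hmem.self_of_nhds
  have hd := (differentiableAt_signedDist hU (hU.frontier_subset hx)).hasFDerivAt.comp x
    hf.hasFDerivAt
  have h0 : (signedDist Ω ∘ f) =ᶠ[nhds x] fun _ => 0 := by
    filter_upwards [hmem] with y hy using signedDist_of_mem_frontier hb hne hy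
  have h1 := hd.unique ((hasFDerivAt_const (0 : ℝ) x).congr_of_eventuallyEq h0)
  exact congrArg (fun L : F →L[ℝ] ℝ => L v) h1

theorem tangentProj_of_mem {p v : E3} (hv : v ∈ tangentPlane Ω p) :
    tangentProj Ω p v = ⟨v, hv⟩ := by
  rw [tangentProj]
  exact Submodule.orthogonalProjectionOnto_mem_subspace_eq_self (⟨v, hv⟩ : tangentPlane Ω p)

/-- The inner collar `{x ∈ closure Ω : s ≤ ρ(x)}`. -/
def innerCollar (Ω : Set E3) (s : ℝ) : Set E3 := {x | x ∈ closure Ω ∧ s ≤ signedDist Ω x}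

theorem isCompact_innerCollar (hb : Bornology.IsBounded Ω) (hne : Ω.Nonempty) (s : ℝ) :
    IsCompact (innerCollar Ω s) := by
  have h : innerCollar Ω s = closure Ω ∩ {x | Metric.infDist x (frontier Ω) ≤ -s} := by
    ext x
    simp only [innerCollar, mem_ofPred_eq, mem_inter_iff]
    refine and_congr_right fun hx => ?_
    rw [signedDist_of_mem_closure hb hne hx, le_neg]
  rw [h]
  exact hb.isCompact_closure.inter_right
    (isClosed_le (Metric.continuous_infDist_pt _) continuous_const)

theorem signedDist_nonpos (hb : Bornology.IsBounded Ω) (hne : Ω.Nonempty) {x : E3}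
    (hx : x ∈ closure Ω) : signedDist Ω x ≤ 0 := by
  rw [signedDist_of_mem_closure hb hne hx]
  exact neg_nonpos.2 Metric.infDist_nonneg

theorem innerCollar_subset_collar (hb : Bornology.IsBounded Ω) (hne : Ω.Nonempty) {s r₀ : ℝ}
    (hs : -(2 * r₀) ≤ s) : innerCollar Ω s ⊆ collar Ω r₀ :=
  fun _ hx => ⟨hs.trans hx.2, signedDist_nonpos hb hne hx.1⟩

theorem closure_subset_union (hU : IsTubularNhd Ω U) : closure Ω ⊆ Ω ∪ U := by
  rw [closure_eq_self_union_frontier]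
  exact union_subset_union_right _ hU.frontier_subset

theorem eventually_signedDist_lt (hΩ : IsOpen Ω) (hb : Bornology.IsBounded Ω) (hne : Ω.Nonempty)
    {x : E3} (hx : x ∈ Ω) {s : ℝ} (hs : signedDist Ω x < s) :
    ∀ᶠ y in nhds x, signedDist Ω y < s := by
  rw [signedDist_of_mem hb hne hx] at hs
  filter_upwards [hΩ.mem_nhds hx,
    (Metric.continuous_infDist_pt (frontier Ω)).neg.continuousAt.eventually_lt_const hs]
    with y hy hys
  rw [signedDist_of_mem hb hne hy]
  exact hys

end Geometry

/-! ### The profile `E_λ` -/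

section Profile

variable {ψ : ℝ → ℝ}

theorem exists_forall_le_eq_zero {a b : ℝ} (hab : a < b) (h : tsupport ψ ⊆ Ioo a b) :
    ∃ s, a < s ∧ ∀ r ≤ s, ψ r = 0 := by
  by_cases hne : (tsupport ψ).Nonempty
  · have hc : IsCompact (tsupport ψ) :=
      (isCompact_Icc (a := a) (b := b)).of_isClosed_subset (isClosed_tsupport ψ)
        (h.trans Ioo_subset_Icc_self)
    obtain ⟨s₁, hs₁, hmin⟩ := hc.exists_isLeast hne
    refine ⟨(a + s₁) / 2, by linarith [(h hs₁).1], fun r hr => ?_⟩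
    by_contra h0
    have := hmin (subset_tsupport ψ h0)
    linarith [(h hs₁).1]
  · refine ⟨b, hab, fun r _ => ?_⟩
    by_contra h0
    exact hne ⟨r, subset_tsupport ψ h0⟩

theorem hasCompactSupport_of_tsupport_subset_Ioo {a b : ℝ} (h : tsupport ψ ⊆ Ioo a b) :
    HasCompactSupport ψ :=
  (isCompact_Icc (a := a) (b := b)).of_isClosed_subset (isClosed_tsupport ψ)
    (h.trans Ioo_subset_Icc_self)

theorem continuous_exp_mul (hψ : Continuous ψ) (lam : ℝ) :
    Continuous fun s => Real.exp (s / lam) * ψ s := by fun_prop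

theorem integrable_exp_mul (hψ : Continuous ψ) (hc : HasCompactSupport ψ) (lam : ℝ) :
    Integrable fun s => Real.exp (s / lam) * ψ s :=
  (continuous_exp_mul hψ lam).integrable_of_hasCompactSupport hc.mul_left

theorem expPrimitive_eq_add (hψ : Continuous ψ) (hc : HasCompactSupport ψ) (lam s r : ℝ) :
    expPrimitive ψ lam r = expPrimitive ψ lam s + ∫ t in s..r, Real.exp (t / lam) * ψ t := by
  have hi := integrable_exp_mul hψ hc lam
  have := intervalIntegral.integral_Iic_sub_Iic (a := s) (b := r) hi.integrableOn hi.integrableOn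
  rw [← this, expPrimitive, expPrimitive]
  ring

theorem hasDerivAt_expPrimitive (hψ : Continuous ψ) (hc : HasCompactSupport ψ) (lam r : ℝ) :
    HasDerivAt (expPrimitive ψ lam) (Real.exp (r / lam) * ψ r) r := by
  have h := ((continuous_exp_mul hψ lam).integral_hasStrictDerivAt 0 r).hasDerivAt.const_add
    (expPrimitive ψ lam 0)
  exact h.congr_of_eventuallyEq (Filter.Eventually.of_forall fun t =>
    expPrimitive_eq_add hψ hc lam 0 t)

theorem contDiff_exp_mul (hψ : ContDiff ℝ ∞ ψ) (lam : ℝ) :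
    ContDiff ℝ ∞ fun s => Real.exp (s / lam) * ψ s :=
  (contDiff_id.div_const lam).exp.mul hψ

theorem contDiff_expPrimitive (hψ : ContDiff ℝ ∞ ψ) (hc : HasCompactSupport ψ) (lam : ℝ) :
    ContDiff ℝ ∞ (expPrimitive ψ lam) := by
  have hd := hasDerivAt_expPrimitive hψ.continuous hc lam
  rw [contDiff_infty_iff_deriv]
  refine ⟨fun r => (hd r).differentiableAt, ?_⟩
  rw [funext fun r => (hd r).deriv]
  exact contDiff_exp_mul hψ lam

theorem expPrimitive_eq_zero {s : ℝ} (hs : ∀ r ≤ s, ψ r = 0) (lam : ℝ) {r : ℝ} (hr : r ≤ s) :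
    expPrimitive ψ lam r = 0 := by
  rw [expPrimitive, setIntegral_congr_fun measurableSet_Iic (g := fun _ => (0 : ℝ))]
  · simp
  · intro t ht
    simp [hs t (ht.trans hr)]

theorem abs_expPrimitive_le_mul {M : ℝ} (hM : ∀ r, |ψ r| ≤ M) {lam : ℝ} (hlam : 0 < lam)
    (r : ℝ) : |expPrimitive ψ lam r| ≤ M * lam * Real.exp (r / lam) := by
  have hI : ∫ s in Iic r, Real.exp (lam⁻¹ * s) = Real.exp (lam⁻¹ * r) / lam⁻¹ :=
    integral_exp_mul_Iic (inv_pos.2 hlam) r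
  have hint : IntegrableOn (fun s => Real.exp (lam⁻¹ * s)) (Iic r) :=
    integrableOn_exp_mul_Iic (inv_pos.2 hlam) r
  have h := norm_integral_le_of_norm_le (μ := volume.restrict (Iic r))
    (f := fun s => Real.exp (s / lam) * ψ s) (hint.const_mul M) (Filter.Eventually.of_forall ?_)
  · rw [integral_const_mul, hI] at h
    refine h.trans (le_of_eq ?_)
    rw [div_inv_eq_mul, div_eq_inv_mul]
    ring
  · intro s
    rw [norm_mul, Real.norm_eq_abs, Real.norm_eq_abs, Real.abs_exp, div_eq_inv_mul, mul_comm]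
    exact mul_le_mul_of_nonneg_right (hM s) (Real.exp_pos _).le

/-- Besides `|E_λ(r)| ≤ M λ e^{r/λ}` there is a bound without the factor `λ`, which serves for
large `λ`. -/
theorem abs_expPrimitive_le (hψ : Continuous ψ) (hc : HasCompactSupport ψ)
    {M : ℝ} (hM : ∀ r, |ψ r| ≤ M) {s : ℝ} (hs : ∀ r ≤ s, ψ r = 0) {lam : ℝ} (hlam : 0 < lam)
    {r : ℝ} (hr : r ≤ 0) : |expPrimitive ψ lam r| ≤ M * |s| * Real.exp (r / lam) := by
  have hM0 : 0 ≤ M := (abs_nonneg _).trans (hM 0)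
  rcases le_total r s with hrs | hrs
  · rw [expPrimitive_eq_zero hs lam hrs, abs_zero]
    positivity
  · rw [expPrimitive_eq_add hψ hc lam s r, expPrimitive_eq_zero hs lam le_rfl, zero_add]
    have h := intervalIntegral.norm_integral_le_of_norm_le_const (a := s) (b := r)
      (f := fun t => Real.exp (t / lam) * ψ t) (C := Real.exp (r / lam) * M) ?_
    · refine h.trans ?_
      have h1 : |r - s| ≤ |s| := by
        rw [abs_of_nonneg (by linarith), abs_of_nonpos (by linarith)]; linarith
      calc Real.exp (r / lam) * M * |r - s| ≤ Real.exp (r / lam) * M * |s| := by gcongr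
        _ = M * |s| * Real.exp (r / lam) := by ring
    · intro t ht
      rw [uIoc_of_le hrs] at ht
      rw [norm_mul, Real.norm_eq_abs, Real.norm_eq_abs, Real.abs_exp]
      gcongr
      · exact ht.2
      · exact hM t

end Profile

/-! ### The pulled back form and `β_λ` -/

section Pullback

theorem minSmoothness_two_le : minSmoothness ℝ 2 ≤ (∞ : ℕ∞ω) := by
  rw [minSmoothness_of_isRCLikeNormedField]
  exact WithTop.coe_le_coe.2 (le_top : (2 : ℕ∞) ≤ ⊤)

variable {Ω U : Set E3}

/-- A covector as an alternating form of degree one. -/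
abbrev ofCovector (a : E3 →L[ℝ] ℝ) : Form 1 :=
  ContinuousAlternatingMap.ofSubsingleton ℝ E3 ℝ (0 : Fin 1) a

theorem contDiff_ofCovector : ContDiff ℝ ∞ ofCovector :=
  (ContinuousAlternatingMap.ofSubsingletonLIE (𝕜 := ℝ) (E := E3) (F := ℝ) (0 : Fin 1)).contDiff

/-- Near a point of the tubular neighbourhood, `π^*γ₀` is the pull-back under `π` of a smooth
1-form of `ℝ³`. -/
theorem exists_eventually_pullback_eq (hb : Bornology.IsBounded Ω) (hne : Ω.Nonempty)
    (hU : IsTubularNhd Ω U) {γ₀ : BoundaryOneForm Ω} (hγ₀ : γ₀.IsSmooth) {x : E3} (hx : x ∈ U) :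
    ∃ α : E3 → (E3 →L[ℝ] ℝ), ContDiffAt ℝ ∞ α (nearestPoint Ω x) ∧
      ∀ᶠ y in nhds x, pullback Ω γ₀ y =
        ofCovector ((α (nearestPoint Ω y)).comp (fderiv ℝ (nearestPoint Ω) y)) := by
  obtain ⟨W, hW, hxW, α, hα, hαγ⟩ := hγ₀ _ (nearestPoint_mem hb hne x)
  refine ⟨α, hα.contDiffAt (hW.mem_nhds hxW), ?_⟩
  have hev := (differentiableAt_nearestPoint hU hx).continuousAt.eventually (hW.mem_nhds hxW)
  filter_upwards [hev, hU.isOpen.mem_nhds hx] with y hyW hyU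
  have hy := nearestPoint_mem hb hne y
  rw [pullback, dif_pos hy]
  congr 1
  ext v
  have hv : fderiv ℝ (nearestPoint Ω) y v ∈ tangentPlane Ω (nearestPoint Ω y) :=
    fderiv_mem_tangentPlane hb hne hU (differentiableAt_nearestPoint hU hyU)
      (Filter.Eventually.of_forall fun z => nearestPoint_mem hb hne z) v
  simp only [ContinuousLinearMap.comp_apply]
  rw [tangentProj_of_mem hv, ← hαγ ⟨_, hy⟩ hyW]

theorem contDiffOn_pullback (hb : Bornology.IsBounded Ω) (hne : Ω.Nonempty)
    (hU : IsTubularNhd Ω U) {γ₀ : BoundaryOneForm Ω} (hγ₀ : γ₀.IsSmooth) :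
    ContDiffOn ℝ ∞ (pullback Ω γ₀) U := by
  intro x hx
  obtain ⟨α, hα, hev⟩ := exists_eventually_pullback_eq hb hne hU hγ₀ hx
  have hπ := hU.contDiffOn_nearestPoint.contDiffAt (hU.isOpen.mem_nhds hx)
  have hdπ := (hU.contDiffOn_nearestPoint.fderiv_of_isOpen (m := ∞) hU.isOpen (by simp)).contDiffAt
    (hU.isOpen.mem_nhds hx)
  refine ContDiffAt.contDiffWithinAt (ContDiffAt.congr_of_eventuallyEq ?_ hev)
  exact contDiff_ofCovector.contDiffAt.comp x ((hα.comp x hπ).clm_comp hdπ)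

/-- `i_n d(π^*γ₀) = 0` on `∂Ω`, because `d` commutes with pull-back and `Dπ(p) n = 0`. -/
theorem extDeriv_pullback_normal (hΩ : IsOpen Ω) (hb : Bornology.IsBounded Ω) (hne : Ω.Nonempty)
    (hU : IsTubularNhd Ω U) {γ₀ : BoundaryOneForm Ω} (hγ₀ : γ₀.IsSmooth) {p : E3}
    (hp : p ∈ frontier Ω) (w : E3) : extDeriv (pullback Ω γ₀) p ![normal Ω p, w] = 0 := by
  have hpU := hU.frontier_subset hp
  obtain ⟨α, hα, hev⟩ := exists_eventually_pullback_eq hb hne hU hγ₀ hpU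
  have hπ := hU.contDiffOn_nearestPoint.contDiffAt (hU.isOpen.mem_nhds hpU)
  have hA : ContDiffAt ℝ ∞ (fun q => ofCovector (α q)) (nearestPoint Ω p) :=
    contDiff_ofCovector.contDiffAt.comp _ hα
  have hev' : pullback Ω γ₀ =ᶠ[nhds p] fun y =>
      (ofCovector (α (nearestPoint Ω y))).compContinuousLinearMap
        (fderiv ℝ (nearestPoint Ω) y) := by
    filter_upwards [hev] with y hy
    rw [hy]
    rfl
  have hd : extDeriv (fun y => (ofCovector (α (nearestPoint Ω y))).compContinuousLinearMap
      (fderiv ℝ (nearestPoint Ω) y)) p =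
      (extDeriv (fun q => ofCovector (α q)) (nearestPoint Ω p)).compContinuousLinearMap
        (fderiv ℝ (nearestPoint Ω) p) :=
    extDeriv_pullback (hA.differentiableAt (by simp)) hπ minSmoothness_two_le
  rw [hev'.extDeriv_eq, hd, ContinuousAlternatingMap.compContinuousLinearMap_apply]
  refine ContinuousAlternatingMap.map_coord_zero _ (0 : Fin 2) ?_
  simp [fderiv_nearestPoint_of_mem_frontier hb hne hU hp,
    fderiv_signedDist_normal hΩ hb hne hU hp]

theorem pullback_apply_of_mem_tangentPlane (hb : Bornology.IsBounded Ω) (hne : Ω.Nonempty)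
    (hU : IsTubularNhd Ω U) (γ₀ : BoundaryOneForm Ω) (p : frontier Ω) {w : E3}
    (hw : w ∈ tangentPlane Ω (p : E3)) : pullback Ω γ₀ p (fun _ => w) = γ₀ p ⟨w, hw⟩ := by
  have hmem := nearestPoint_mem hb hne (p : E3)
  have hD : fderiv ℝ (nearestPoint Ω) p w = w := by
    rw [fderiv_nearestPoint_of_mem_frontier hb hne hU p.2, mem_tangentPlane_iff.1 hw]
    simp
  have key : ∀ (q : E3) (hq : q ∈ frontier Ω), q = p →
      γ₀ ⟨q, hq⟩ (tangentProj Ω q w) = γ₀ p ⟨w, hw⟩ := by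
    rintro q hq rfl
    rw [tangentProj_of_mem hw]
  rw [pullback, dif_pos hmem]
  simp only [ContinuousAlternatingMap.ofSubsingleton_apply_apply, ContinuousLinearMap.comp_apply,
    hD]
  exact key _ hmem (nearestPoint_of_mem_frontier hb hne p.2)

variable {ψ : ℝ → ℝ}

theorem contDiffOn_expPrimitive_smul_pullback (hb : Bornology.IsBounded Ω) (hne : Ω.Nonempty)
    (hU : IsTubularNhd Ω U) {γ₀ : BoundaryOneForm Ω} (hγ₀ : γ₀.IsSmooth)
    (hψ : ContDiff ℝ ∞ ψ) (hc : HasCompactSupport ψ) (lam : ℝ) :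
    ContDiffOn ℝ ∞ (fun y => expPrimitive ψ lam (signedDist Ω y) • pullback Ω γ₀ y) U :=
  ((contDiff_expPrimitive hψ hc lam).comp_contDiffOn hU.contDiffOn_signedDist).smul
    (contDiffOn_pullback hb hne hU hγ₀)

theorem fderiv_comp_signedDist (hU : IsTubularNhd Ω U) {h : ℝ → ℝ} {h' : ℝ} {x : E3} (hx : x ∈ U)
    (hh : HasDerivAt h h' (signedDist Ω x)) :
    HasFDerivAt (fun y => h (signedDist Ω y)) (h' • fderiv ℝ (signedDist Ω) x) x :=
  hh.comp_hasFDerivAt x (differentiableAt_signedDist hU hx).hasFDerivAt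

/-- Leibniz rule for the product of a function of `ρ` and a form. -/
theorem extDeriv_comp_signedDist_smul (hU : IsTubularNhd Ω U) {k : ℕ} {h : ℝ → ℝ} {h' : ℝ}
    {η : E3 → Form k} (hη : ContDiffOn ℝ ∞ η U) {x : E3} (hx : x ∈ U)
    (hh : HasDerivAt h h' (signedDist Ω x)) :
    extDeriv (fun y => h (signedDist Ω y) • η y) x =
      h' • wedge (fderiv ℝ (signedDist Ω) x) (η x) + h (signedDist Ω x) • extDeriv η x := by
  have hd := fderiv_comp_signedDist hU hx hh
  have hηd : DifferentiableAt ℝ η x :=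
    (hη.contDiffAt (hU.isOpen.mem_nhds hx)).differentiableAt (by simp)
  rw [extDeriv_smul_fun hd.differentiableAt hηd, hd.fderiv, wedge_smul_left]

theorem beta_eq (hb : Bornology.IsBounded Ω) (hne : Ω.Nonempty)
    (hU : IsTubularNhd Ω U) {γ₀ : BoundaryOneForm Ω} (hγ₀ : γ₀.IsSmooth)
    (hψ : ContDiff ℝ ∞ ψ) (hc : HasCompactSupport ψ) (lam : ℝ) {x : E3} (hx : x ∈ U) :
    beta Ω ψ γ₀ lam x =
      (Real.exp (signedDist Ω x / lam) * ψ (signedDist Ω x)) •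
          wedge (fderiv ℝ (signedDist Ω) x) (pullback Ω γ₀ x) +
        expPrimitive ψ lam (signedDist Ω x) • extDeriv (pullback Ω γ₀) x :=
  extDeriv_comp_signedDist_smul hU (contDiffOn_pullback hb hne hU hγ₀) hx
    (hasDerivAt_expPrimitive hψ.continuous hc lam _)

theorem eventually_beta_eq_zero (hΩ : IsOpen Ω) (hb : Bornology.IsBounded Ω) (hne : Ω.Nonempty)
    (γ₀ : BoundaryOneForm Ω) {s : ℝ} (hs : ∀ r ≤ s, ψ r = 0) (lam : ℝ) {x : E3} (hx : x ∈ Ω)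
    (hxs : signedDist Ω x < s) : beta Ω ψ γ₀ lam =ᶠ[nhds x] fun _ => 0 := by
  have h : (fun y => expPrimitive ψ lam (signedDist Ω y) • pullback Ω γ₀ y) =ᶠ[nhds x]
      fun _ => 0 := by
    filter_upwards [eventually_signedDist_lt hΩ hb hne hx hxs] with y hy
    rw [expPrimitive_eq_zero hs lam hy.le, zero_smul]
  have h2 := h.extDeriv
  rw [extDeriv_zero] at h2
  exact h2

theorem contDiffAt_beta (hΩ : IsOpen Ω) (hb : Bornology.IsBounded Ω) (hne : Ω.Nonempty)
    (hU : IsTubularNhd Ω U) {γ₀ : BoundaryOneForm Ω} (hγ₀ : γ₀.IsSmooth)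
    (hψ : ContDiff ℝ ∞ ψ) (hc : HasCompactSupport ψ) {s r₀ : ℝ} (hV : collar Ω r₀ ⊆ U)
    (hs : ∀ r ≤ s, ψ r = 0) (hsr : -(2 * r₀) < s) (lam : ℝ) {x : E3} (hx : x ∈ Ω ∪ U) :
    ContDiffAt ℝ ∞ (beta Ω ψ γ₀ lam) x ∧ extDeriv (beta Ω ψ γ₀ lam) x = 0 := by
  by_cases hxU : x ∈ U
  · have h := contDiffOn_expPrimitive_smul_pullback hb hne hU hγ₀ hψ hc lam
    exact ⟨(contDiffOn_extDeriv hU.isOpen h).contDiffAt (hU.isOpen.mem_nhds hxU),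
      extDeriv_extDeriv_apply (h.contDiffAt (hU.isOpen.mem_nhds hxU)) minSmoothness_two_le⟩
  · have hxΩ : x ∈ Ω := hx.resolve_right hxU
    have hlt : signedDist Ω x < -(2 * r₀) := by
      by_contra hcon
      exact hxU (hV ⟨not_lt.1 hcon, signedDist_nonpos hb hne (subset_closure hxΩ)⟩)
    have hev := eventually_beta_eq_zero hΩ hb hne γ₀ hs lam hxΩ (hlt.trans hsr)
    refine ⟨contDiffAt_const.congr_of_eventuallyEq hev, ?_⟩
    rw [hev.extDeriv_eq, extDeriv_zero]

theorem restrictOne_star_beta (hΩ : IsOpen Ω) (hb : Bornology.IsBounded Ω) (hne : Ω.Nonempty)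
    (hU : IsTubularNhd Ω U) {γ₀ : BoundaryOneForm Ω} (hγ₀ : γ₀.IsSmooth)
    (hψ : ContDiff ℝ ∞ ψ) (hc : HasCompactSupport ψ) (hψ0 : ψ 0 = 1) (lam : ℝ) :
    restrictOne Ω (fun x => star (beta Ω ψ γ₀ lam x)) = starBoundary Ω γ₀ := by
  funext p
  ext ⟨v, hv⟩
  have hpU := hU.frontier_subset p.2
  have hn : ∀ i, fderiv ℝ (signedDist Ω) p (e3 i) = normal Ω p i :=
    fderiv_signedDist_e3 (Ω := Ω) p
  have h1 : star (extDeriv (pullback Ω γ₀) p) (fun _ => v) = 0 := by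
    refine star_apply_eq_zero (extDeriv_pullback_normal hΩ hb hne hU hγ₀ p.2) ?_ ?_
    · simp only [← hn]
      exact sum_fderiv_signedDist_sq hΩ hb hne hU hpU
    · rw [tangentPlane, Submodule.mem_orthogonal_singleton_iff_inner_right] at hv
      rw [← hv, PiLp.inner_apply]
      simp [mul_comm]
  change star (beta Ω ψ γ₀ lam p) (fun _ => v) = γ₀ p ⟨cross v (normal Ω p), _⟩
  rw [beta_eq hb hne hU hγ₀ hψ hc lam hpU, star_add, star_smul, star_smul,
    signedDist_of_mem_frontier hb hne p.2]
  simp only [ContinuousAlternatingMap.add_apply, ContinuousAlternatingMap.smul_apply, h1, hψ0]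
  rw [star_wedge_apply hn, pullback_apply_of_mem_tangentPlane hb hne hU γ₀ p
    (cross_mem_tangentPlane Ω p v)]
  simp

theorem restrictTwo_beta (hb : Bornology.IsBounded Ω) (hne : Ω.Nonempty)
    (hU : IsTubularNhd Ω U) {γ₀ : BoundaryOneForm Ω} (hγ₀ : γ₀.IsSmooth)
    (hψ : ContDiff ℝ ∞ ψ) (hc : HasCompactSupport ψ) (lam : ℝ) :
    restrictTwo Ω (beta Ω ψ γ₀ lam) =
      fun p => expPrimitive ψ lam 0 • restrictTwo Ω (extDeriv (pullback Ω γ₀)) p := by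
  funext p
  ext v
  have hpU := hU.frontier_subset p.2
  simp only [restrictTwo, ContinuousAlternatingMap.compContinuousLinearMap_apply,
    ContinuousAlternatingMap.smul_apply]
  rw [beta_eq hb hne hU hγ₀ hψ hc lam hpU, signedDist_of_mem_frontier hb hne p.2]
  simp [wedge_one_apply, mem_tangentPlane_iff.1 (v 0).2, mem_tangentPlane_iff.1 (v 1).2]

end Pullback

/-! ### Volume of thin collars -/

section Volume

theorem volume_box (a b : Fin 3 → ℝ) :
    volume {y : E3 | ∀ j, y j ∈ Icc (a j) (b j)} = ∏ j, ENNReal.ofReal (b j - a j) := by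
  have h : {y : E3 | ∀ j, y j ∈ Icc (a j) (b j)} = WithLp.ofLp ⁻¹' (Icc a b) := by
    ext y
    simp only [mem_ofPred_eq, mem_preimage, mem_Icc, Pi.le_def]
    exact forall_and
  rw [h, (PiLp.volume_preserving_ofLp (Fin 3)).measure_preimage measurableSet_Icc.nullMeasurableSet,
    Real.volume_Icc_pi]

/-- Near a point where `∂_i f ≠ 0`, the map replacing the `i`-th coordinate by `f` is a local
diffeomorphism; it takes `{-t ≤ f ≤ 0}` into a box of side `t` in the `i`-th direction. -/
theorem exists_nhds_volume_le {f : E3 → ℝ} {x₀ : E3} (hf : ContDiffAt ℝ ∞ f x₀)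
    (hdf : fderiv ℝ f x₀ ≠ 0) :
    ∃ N ∈ nhds x₀, ∃ C : ℝ, 0 ≤ C ∧ ∀ t : ℝ, 0 ≤ t →
      volume (N ∩ {x | -t ≤ f x ∧ f x ≤ 0}) ≤ ENNReal.ofReal (C * t) := by
  obtain ⟨i, hi⟩ : ∃ i, fderiv ℝ f x₀ (e3 i) ≠ 0 := by
    by_contra! hcon
    apply hdf
    ext v
    rw [← sum_smul_e3 v]
    simp [hcon]
  have hsf : HasStrictFDerivAt f (fderiv ℝ f x₀) x₀ := hf.hasStrictFDerivAt (by simp)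
  let pr : E3 →L[ℝ] ℝ := EuclideanSpace.proj i
  let A : E3 →L[ℝ] E3 := ContinuousLinearMap.id ℝ E3 + (fderiv ℝ f x₀ - pr).smulRight (e3 i)
  let Φ : E3 → E3 := fun x => x + (f x - pr x) • e3 i
  have hΦ : HasStrictFDerivAt Φ A x₀ :=
    (hasStrictFDerivAt_id x₀).add ((hsf.sub pr.hasStrictFDerivAt).smul_const (e3 i))
  have hΦi : ∀ x, Φ x i = f x := fun x => by simp [Φ, pr, e3]
  have hΦj : ∀ x j, j ≠ i → Φ x j = x j := fun x j hj => by simp [Φ, pr, e3, hj]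
  -- `A v = 0` forces `v = v_i e_i` and then `v_i ∂_i f(x₀) = 0`
  have hAdet : A.det ≠ 0 := by
    intro h0
    have hker := LinearMap.bot_lt_ker_of_det_eq_zero (f := (A : E3 →ₗ[ℝ] E3)) h0
    obtain ⟨v, hv, hv0⟩ := Submodule.exists_mem_ne_zero_of_ne_bot hker.ne'
    have hAv : v + (fderiv ℝ f x₀ v - v i) • e3 i = 0 := hv
    have hvj : ∀ j, j ≠ i → v j = 0 := by
      intro j hj
      have := congrArg (fun w : E3 => w j) hAv
      simpa [e3, hj] using this
    have hvi : v = v i • e3 i := by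
      ext j
      by_cases hj : j = i
      · subst hj; simp [e3]
      · simp [e3, hj, hvj j hj]
    have h1 : fderiv ℝ f x₀ v = 0 := by
      have := congrArg (fun w : E3 => w i) hAv
      simpa [e3] using this
    rw [hvi, map_smul, smul_eq_mul] at h1
    have h2 : v i = 0 := (mul_eq_zero.1 h1).resolve_right hi
    apply hv0
    rw [hvi, h2, zero_smul]
  let m : NNReal := Real.toNNReal (|A.det| / 2)
  have hmpos : 0 < |A.det| / 2 := by positivity
  have hm : (m : ℝ≥0∞) < ENNReal.ofReal |A.det| :=
    (ENNReal.ofReal_lt_ofReal_iff (by linarith)).2 (by linarith)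
  have hm0 : (m : ℝ≥0∞) = ENNReal.ofReal (|A.det| / 2) := rfl
  obtain ⟨δ, hδ, hδpos⟩ := ((mul_le_addHaar_image_of_lt_det (μ := volume) A hm).and
    self_mem_nhdsWithin).exists
  obtain ⟨s, hs, happ⟩ := hΦ.approximates_deriv_on_nhds (c := δ) (Or.inr hδpos)
  refine ⟨s ∩ Metric.ball x₀ 1, Filter.inter_mem hs (Metric.ball_mem_nhds x₀ one_pos),
    (|A.det| / 2)⁻¹ * 4, by positivity, fun t ht => ?_⟩
  set S := s ∩ Metric.ball x₀ 1 ∩ {x | -t ≤ f x ∧ f x ≤ 0} with hS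
  have h1 := hδ S Φ (happ.mono_set (fun x hx => hx.1.1))
  have h2 : Φ '' S ⊆ {y : E3 | ∀ j, y j ∈ Icc (if j = i then -t else x₀ j - 1)
      (if j = i then 0 else x₀ j + 1)} := by
    rintro _ ⟨x, hx, rfl⟩ j
    by_cases hj : j = i
    · subst hj
      simp only [if_true, hΦi]
      exact hx.2
    · simp only [if_neg hj, hΦj x j hj]
      have h3 : ‖(x - x₀) j‖ ≤ ‖x - x₀‖ := PiLp.norm_apply_le _ j
      have h4 : ‖x - x₀‖ < 1 := by rw [← dist_eq_norm]; exact hx.1.2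
      have h5 := abs_le.1 (h3.trans h4.le)
      simp only [PiLp.sub_apply] at h5
      exact ⟨by linarith [h5.1], by linarith [h5.2]⟩
  have hprod : ∀ i : Fin 3, ∏ j, ((if j = i then 0 else x₀ j + 1) -
      (if j = i then -t else x₀ j - 1)) = 4 * t := by
    intro i
    have h1 : ∀ j, ((if j = i then 0 else x₀ j + 1) - (if j = i then -t else x₀ j - 1)) =
        if j = i then t else 2 := fun j => by split_ifs <;> ring
    simp only [h1, Finset.prod_ite, Finset.prod_const]
    have h2 : ∀ i : Fin 3, (Finset.univ.filter fun j => j = i).card = 1 := by decide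
    have h3 : ∀ i : Fin 3, (Finset.univ.filter fun j => ¬j = i).card = 2 := by decide
    rw [h2, h3]
    ring
  have h3 : volume (Φ '' S) ≤ ENNReal.ofReal (4 * t) := by
    refine (measure_mono h2).trans (le_of_eq ?_)
    rw [volume_box, ← ENNReal.ofReal_prod_of_nonneg]
    · congr 1
      exact hprod i
    · intro j _
      split_ifs <;> linarith
  rw [hm0] at h1
  have hne0 : ENNReal.ofReal (|A.det| / 2) ≠ 0 := by simpa using hAdet
  calc volume S = (ENNReal.ofReal (|A.det| / 2))⁻¹ * (ENNReal.ofReal (|A.det| / 2) * volume S) := by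
        rw [← mul_assoc, ENNReal.inv_mul_cancel hne0 ENNReal.ofReal_ne_top, one_mul]
    _ ≤ (ENNReal.ofReal (|A.det| / 2))⁻¹ * ENNReal.ofReal (4 * t) := by
        gcongr
        exact h1.trans h3
    _ = ENNReal.ofReal ((|A.det| / 2)⁻¹ * 4 * t) := by
        rw [← ENNReal.ofReal_inv_of_pos hmpos, ← ENNReal.ofReal_mul (by positivity), mul_assoc]

theorem exists_volume_collar_le {f : E3 → ℝ} {U K : Set E3} (hU : IsOpen U)
    (hf : ContDiffOn ℝ ∞ f U) (hdf : ∀ x ∈ U, fderiv ℝ f x ≠ 0) (hK : IsCompact K) (hKU : K ⊆ U) :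
    ∃ C : ℝ, 0 ≤ C ∧ ∀ t : ℝ, 0 ≤ t →
      volume (K ∩ {x | -t ≤ f x ∧ f x ≤ 0}) ≤ ENNReal.ofReal (C * t) := by
  refine hK.induction_on (p := fun S => ∃ C : ℝ, 0 ≤ C ∧ ∀ t : ℝ, 0 ≤ t →
    volume (S ∩ {x | -t ≤ f x ∧ f x ≤ 0}) ≤ ENNReal.ofReal (C * t)) ?_ ?_ ?_ ?_
  · exact ⟨0, le_rfl, fun t _ => by simp⟩
  · rintro S T hST ⟨C, hC, h⟩
    exact ⟨C, hC, fun t ht => (measure_mono (inter_subset_inter_left _ hST)).trans (h t ht)⟩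
  · rintro S T ⟨C, hC, h⟩ ⟨D, hD, h'⟩
    refine ⟨C + D, add_nonneg hC hD, fun t ht => ?_⟩
    rw [union_inter_distrib_right, add_mul, ENNReal.ofReal_add (by positivity) (by positivity)]
    exact (measure_union_le _ _).trans (add_le_add (h t ht) (h' t ht))
  · intro x hx
    obtain ⟨N, hN, h⟩ := exists_nhds_volume_le (hf.contDiffAt (hU.mem_nhds (hKU hx)))
      (hdf x (hKU hx))
    exact ⟨N, mem_nhdsWithin_of_mem_nhds hN, h⟩

/-- A 2-form on `Ω` supported in the inner collar and bounded there by `B e^{ρ/λ}` has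
`L²`-norm `O(B √λ)`: where `-(k+1)λ ≤ ρ ≤ -kλ` the bound is at most `B e^{-k}`, and the part
`{-(k+1)λ ≤ ρ}` of the collar has volume `O((k+1)λ)`. -/
theorem exists_normL2_le {Ω U : Set E3} (hΩ : IsOpen Ω) (hb : Bornology.IsBounded Ω)
    (hne : Ω.Nonempty) (hU : IsTubularNhd Ω U) {s : ℝ} (hsU : innerCollar Ω s ⊆ U) :
    ∃ C : ℝ, 0 ≤ C ∧ ∀ (lam B : ℝ) (η : E3 → Form 2), 0 < lam → 0 ≤ B →
      (∀ x ∈ Ω, x ∉ innerCollar Ω s → η x = 0) →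
      (∀ x ∈ innerCollar Ω s, ‖η x‖ ≤ B * Real.exp (signedDist Ω x / lam)) →
      normL2 Ω η ≤ ENNReal.ofReal (C * B * Real.sqrt lam) := by
  have hgrad : ∀ x ∈ U, fderiv ℝ (signedDist Ω) x ≠ 0 := by
    intro x hx h0
    have := sum_fderiv_signedDist_sq hΩ hb hne hU hx
    simp [h0] at this
  obtain ⟨C, hC, hvol⟩ := exists_volume_collar_le hU.isOpen hU.contDiffOn_signedDist hgrad
    (isCompact_innerCollar hb hne s) hsU
  have hsum : Summable fun k : ℕ => ((k : ℝ) + 1) * Real.exp (-2 * k) := by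
    have h1 := Real.summable_pow_mul_exp_neg_nat_mul 1 (r := 2) two_pos
    have h0 := Real.summable_pow_mul_exp_neg_nat_mul 0 (r := 2) two_pos
    refine (h1.add h0).congr fun k => ?_
    simp [add_mul]
  set S : ℝ := ∑' k : ℕ, ((k : ℝ) + 1) * Real.exp (-2 * k) with hS
  have hS0 : 0 ≤ S := tsum_nonneg fun k => by positivity
  refine ⟨2 * Real.sqrt (C * S), by positivity, fun lam B η hlam hB hzero hbound => ?_⟩
  let L : ℕ → Set E3 := fun k => innerCollar Ω s ∩ innerCollar Ω (-((k + 1) * lam))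
  have hLmeas : ∀ k, MeasurableSet (L k) := fun k =>
    ((isCompact_innerCollar hb hne _).isClosed.inter
      (isCompact_innerCollar hb hne _).isClosed).measurableSet
  have hLvol : ∀ k, volume (L k) ≤ ENNReal.ofReal (C * ((k + 1) * lam)) := fun k =>
    (measure_mono (fun x hx => ⟨hx.1, hx.2.2, signedDist_nonpos hb hne hx.1.1⟩ :
      L k ⊆ innerCollar Ω s ∩ {x | -((k + 1) * lam) ≤ signedDist Ω x ∧ signedDist Ω x ≤ 0})).trans
      (hvol _ (by positivity))
  have hpt : ∀ x ∈ Ω, ‖twoNorm (η x)‖ₑ ^ 2 ≤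
      ∑' k, (L k).indicator (fun _ => ENNReal.ofReal (4 * B ^ 2 * Real.exp (-2 * k))) x := by
    intro x hx
    by_cases hxK : x ∈ innerCollar Ω s
    · have hρ := signedDist_nonpos hb hne hxK.1
      set k : ℕ := ⌊-signedDist Ω x / lam⌋₊ with hk
      have hk1 : (k : ℝ) ≤ -signedDist Ω x / lam :=
        Nat.floor_le (div_nonneg (by linarith) hlam.le)
      have hk2 : -signedDist Ω x / lam < k + 1 := Nat.lt_floor_add_one _
      have hxL : x ∈ L k := by
        refine ⟨hxK, hxK.1, ?_⟩
        rw [div_lt_iff₀ hlam] at hk2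
        linarith
      refine le_trans ?_ (ENNReal.le_tsum k)
      have htn : 0 ≤ twoNorm (η x) := Real.sqrt_nonneg _
      rw [indicator_of_mem hxL, Real.enorm_of_nonneg htn, ← ENNReal.ofReal_pow htn]
      apply ENNReal.ofReal_le_ofReal
      have h1 : twoNorm (η x) ≤ 2 * (B * Real.exp (-k)) := by
        refine (twoNorm_le _).trans (mul_le_mul_of_nonneg_left ((hbound x hxK).trans ?_) two_pos.le)
        refine mul_le_mul_of_nonneg_left (Real.exp_le_exp.2 ?_) hB
        rw [neg_div] at hk1
        linarith
      calc twoNorm (η x) ^ 2 ≤ (2 * (B * Real.exp (-k))) ^ 2 :=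
            pow_le_pow_left₀ (Real.sqrt_nonneg _) h1 2
        _ = 4 * B ^ 2 * Real.exp (-2 * k) := by
            rw [show (-2 * (k : ℝ)) = -k + -k by ring, Real.exp_add]; ring
    · rw [hzero x hx hxK]
      simp [twoNorm, twoCoeff]
  have hint : ∫⁻ x in Ω, ‖twoNorm (η x)‖ₑ ^ 2 ≤ ENNReal.ofReal (4 * B ^ 2 * (C * S * lam)) := by
    calc ∫⁻ x in Ω, ‖twoNorm (η x)‖ₑ ^ 2
        ≤ ∫⁻ x in Ω, ∑' k, (L k).indicator
            (fun _ => ENNReal.ofReal (4 * B ^ 2 * Real.exp (-2 * k))) x :=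
          setLIntegral_mono' hΩ.measurableSet hpt
      _ ≤ ∫⁻ x, ∑' k, (L k).indicator
            (fun _ => ENNReal.ofReal (4 * B ^ 2 * Real.exp (-2 * k))) x :=
          setLIntegral_le_lintegral _ _
      _ = ∑' k : ℕ, ENNReal.ofReal (4 * B ^ 2 * Real.exp (-2 * k)) * volume (L k) := by
          rw [lintegral_tsum fun k => (measurable_const.indicator (hLmeas k)).aemeasurable]
          congr 1
          funext k
          rw [lintegral_indicator_const (hLmeas k)]
      _ ≤ ∑' k : ℕ, ENNReal.ofReal
            (4 * B ^ 2 * (C * lam) * (((k : ℝ) + 1) * Real.exp (-2 * k))) := by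
          refine ENNReal.tsum_le_tsum fun k => ?_
          refine (mul_le_mul_right (hLvol k) _).trans (le_of_eq ?_)
          rw [← ENNReal.ofReal_mul (by positivity)]
          congr 1
          ring
      _ = ENNReal.ofReal (4 * B ^ 2 * (C * S * lam)) := by
          rw [← ENNReal.ofReal_tsum_of_nonneg (fun k => by positivity) (hsum.mul_left _),
            tsum_mul_left]
          congr 1
          rw [← hS]
          ring
  rw [normL2, eLpNorm_eq_lintegral_rpow_enorm_toReal two_ne_zero ENNReal.ofNat_ne_top]
  simp only [ENNReal.toReal_ofNat, ENNReal.rpow_two]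
  calc (∫⁻ x in Ω, ‖twoNorm (η x)‖ₑ ^ 2) ^ (1 / 2 : ℝ)
      ≤ ENNReal.ofReal (4 * B ^ 2 * (C * S * lam)) ^ (1 / 2 : ℝ) :=
        ENNReal.rpow_le_rpow hint (by norm_num)
    _ = ENNReal.ofReal (2 * Real.sqrt (C * S) * B * Real.sqrt lam) := by
        rw [ENNReal.ofReal_rpow_of_nonneg (by positivity) (by norm_num), ← Real.sqrt_eq_rpow]
        congr 1
        rw [Real.sqrt_eq_iff_mul_self_eq (by positivity) (by positivity)]
        have h1 := Real.mul_self_sqrt (mul_nonneg hC hS0)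
        have h2 := Real.mul_self_sqrt hlam.le
        linear_combination (-(4 * B ^ 2 * (Real.sqrt lam * Real.sqrt lam))) * h1 -
          (4 * B ^ 2 * (C * S)) * h2

end Volume

/-! ### The London operator on `β_λ` -/

section LondonOperator

variable {Ω U : Set E3}

/-- The 1-form `⋆(dρ ∧ ⋆η)`, by which `d^*` acts on the factor `h(ρ)` of a product `h(ρ) η`. -/
def starWedgeStar (Ω : Set E3) (η : E3 → Form 2) (x : E3) : Form 1 :=
  star (wedge (fderiv ℝ (signedDist Ω) x) (star (η x)))

theorem contDiffOn_starWedgeStar (hU : IsTubularNhd Ω U) {η : E3 → Form 2}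
    (hη : ContDiffOn ℝ ∞ η U) : ContDiffOn ℝ ∞ (starWedgeStar Ω η) U :=
  contDiffOn_star (contDiffOn_wedge (contDiffOn_fderiv_signedDist hU) (contDiffOn_star hη))

theorem codiff_comp_signedDist_smul (hU : IsTubularNhd Ω U) {h : ℝ → ℝ} {h' : ℝ}
    {η : E3 → Form 2} (hη : ContDiffOn ℝ ∞ η U) {x : E3} (hx : x ∈ U)
    (hh : HasDerivAt h h' (signedDist Ω x)) :
    codiff (fun y => h (signedDist Ω y) • η y) x =
      h' • starWedgeStar Ω η x + h (signedDist Ω x) • codiff η x := by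
  simp only [codiff, star_smul]
  rw [extDeriv_comp_signedDist_smul hU (contDiffOn_star hη) hx hh, star_add, star_smul, star_smul]
  rfl

theorem codiff_add {η θ : E3 → Form 2} {x : E3} (hη : DifferentiableAt ℝ η x)
    (hθ : DifferentiableAt ℝ θ x) :
    codiff (fun y => η y + θ y) x = codiff η x + codiff θ x := by
  simp only [codiff, star_add]
  have h : ∀ {ζ : E3 → Form 2}, DifferentiableAt ℝ ζ x →
      DifferentiableAt ℝ (fun y => star (ζ y)) x := by
    intro ζ hζ
    simp only [← starCLM_apply]
    exact starCLM.differentiableAt.comp x hζ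
  rw [extDeriv_fun_add (h hη) (h hθ), star_add]

theorem codiff_congr {η θ : E3 → Form 2} {x : E3} (h : η =ᶠ[nhds x] θ) :
    codiff η =ᶠ[nhds x] codiff θ := by
  have h1 : (fun y => star (η y)) =ᶠ[nhds x] fun y => star (θ y) := by
    filter_upwards [h] with y hy
    rw [hy]
  filter_upwards [h1.extDeriv] with y hy
  rw [codiff, codiff, hy]

theorem contDiffOn_comp_signedDist_smul (hU : IsTubularNhd Ω U) {k : ℕ} {h : ℝ → ℝ}
    (hh : ContDiff ℝ ∞ h) {η : E3 → Form k} (hη : ContDiffOn ℝ ∞ η U) :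
    ContDiffOn ℝ ∞ (fun y => h (signedDist Ω y) • η y) U :=
  (hh.comp_contDiffOn hU.contDiffOn_signedDist).smul hη

theorem londonOp_eq_zero {lam : ℝ} {η : E3 → Form 2} {x : E3} (h : η =ᶠ[nhds x] fun _ => 0) :
    londonOp lam η x = 0 := by
  have h1 : codiff (fun _ : E3 => (0 : Form 2)) = fun _ => 0 := by
    ext y v
    have hs : star 0 = 0 := by rw [← starCLM_apply, map_zero]
    simp only [codiff, hs, extDeriv_zero]
  rw [londonOp, (codiff_congr h).extDeriv_eq, h.self_of_nhds, h1, extDeriv_zero, smul_zero,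
    add_zero]

/-- On `a(ρ) dρ ∧ γ + f(ρ) τ` with `f' = a`, the operator `dd^* + λ^{-2}` equals
`(λ^{-2} a - a'')(ρ) dρ ∧ γ` up to terms which contain `a` and `f` without derivatives, `a'` once,
or `λ^{-2} f`. -/
theorem exists_londonOp_eq (hΩ : IsOpen Ω) (hb : Bornology.IsBounded Ω) (hne : Ω.Nonempty)
    (hU : IsTubularNhd Ω U) {γ : E3 → Form 1} (hγ : ContDiffOn ℝ ∞ γ U)
    {τ : E3 → Form 2} (hτ : ContDiffOn ℝ ∞ τ U) :
    ∃ P Q R : E3 → Form 2, ContDiffOn ℝ ∞ P U ∧ ContDiffOn ℝ ∞ Q U ∧ ContDiffOn ℝ ∞ R U ∧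
      ∀ (lam : ℝ) (f a a' a'' : ℝ → ℝ), ContDiff ℝ ∞ f → ContDiff ℝ ∞ a → ContDiff ℝ ∞ a' →
        (∀ r, HasDerivAt f (a r) r) → (∀ r, HasDerivAt a (a' r) r) →
        (∀ r, HasDerivAt a' (a'' r) r) → ∀ β : E3 → Form 2,
        (∀ y ∈ U, β y = a (signedDist Ω y) • wedge (fderiv ℝ (signedDist Ω) y) (γ y) +
            f (signedDist Ω y) • τ y) →
        ∀ x ∈ U, londonOp lam β x =
          ((lam ^ 2)⁻¹ * a (signedDist Ω x) - a'' (signedDist Ω x)) •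
              wedge (fderiv ℝ (signedDist Ω) x) (γ x) +
            a' (signedDist Ω x) • P x + a (signedDist Ω x) • Q x + f (signedDist Ω x) • R x +
            ((lam ^ 2)⁻¹ * f (signedDist Ω x)) • τ x := by
  set W : E3 → Form 2 := fun y => wedge (fderiv ℝ (signedDist Ω) y) (γ y) with hWdef
  have hD := contDiffOn_fderiv_signedDist hU
  have hW : ContDiffOn ℝ ∞ W U := contDiffOn_wedge hD hγ
  have hAW := contDiffOn_starWedgeStar hU hW
  have hAT := contDiffOn_starWedgeStar hU hτ
  have hcW := contDiffOn_codiff hU.isOpen hW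
  have hcT := contDiffOn_codiff hU.isOpen hτ
  have hd {k : ℕ} {η : E3 → Form k} (h : ContDiffOn ℝ ∞ η U) {x : E3} (hx : x ∈ U) :
      DifferentiableAt ℝ η x :=
    (h.contDiffAt (hU.isOpen.mem_nhds hx)).differentiableAt (by simp)
  refine ⟨fun x => extDeriv (starWedgeStar Ω W) x +
      (wedge (fderiv ℝ (signedDist Ω) x) (codiff W x) +
        wedge (fderiv ℝ (signedDist Ω) x) (starWedgeStar Ω τ x)),
    fun x => extDeriv (codiff W) x + (extDeriv (starWedgeStar Ω τ) x +
      wedge (fderiv ℝ (signedDist Ω) x) (codiff τ x)),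
    fun x => extDeriv (codiff τ) x,
    (contDiffOn_extDeriv hU.isOpen hAW).add
      ((contDiffOn_wedge hD hcW).add (contDiffOn_wedge hD hAT)),
    (contDiffOn_extDeriv hU.isOpen hcW).add
      ((contDiffOn_extDeriv hU.isOpen hAT).add (contDiffOn_wedge hD hcT)),
    contDiffOn_extDeriv hU.isOpen hcT, ?_⟩
  intro lam f a a' a'' hf ha ha' hfa haa haa' β hβ x hx
  have hcod : codiff β =ᶠ[nhds x] fun y =>
      (a' (signedDist Ω y) • starWedgeStar Ω W y + a (signedDist Ω y) • codiff W y) +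
      (a (signedDist Ω y) • starWedgeStar Ω τ y + f (signedDist Ω y) • codiff τ y) := by
    filter_upwards [hU.isOpen.mem_nhds hx] with y hy
    have hev : β =ᶠ[nhds y] fun z => a (signedDist Ω z) • W z + f (signedDist Ω z) • τ z := by
      filter_upwards [hU.isOpen.mem_nhds hy] with z hz using hβ z hz
    rw [(codiff_congr hev).self_of_nhds,
      codiff_add (hd (contDiffOn_comp_signedDist_smul hU ha hW) hy)
        (hd (contDiffOn_comp_signedDist_smul hU hf hτ) hy),
      codiff_comp_signedDist_smul hU hW hy (haa _), codiff_comp_signedDist_smul hU hτ hy (hfa _)]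
  have h1 := contDiffOn_comp_signedDist_smul hU ha' hAW
  have h2 := contDiffOn_comp_signedDist_smul hU ha hcW
  have h3 := contDiffOn_comp_signedDist_smul hU ha hAT
  have h4 := contDiffOn_comp_signedDist_smul hU hf hcT
  have htriple : wedge (fderiv ℝ (signedDist Ω) x) (starWedgeStar Ω W x) = -W x :=
    wedge_star_wedge_star_wedge (sum_fderiv_signedDist_sq hΩ hb hne hU hx) (γ x)
  have hext : extDeriv (codiff β) x =
      (a'' (signedDist Ω x) • wedge (fderiv ℝ (signedDist Ω) x) (starWedgeStar Ω W x) +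
        a' (signedDist Ω x) • extDeriv (starWedgeStar Ω W) x +
        (a' (signedDist Ω x) • wedge (fderiv ℝ (signedDist Ω) x) (codiff W x) +
        a (signedDist Ω x) • extDeriv (codiff W) x)) +
      (a' (signedDist Ω x) • wedge (fderiv ℝ (signedDist Ω) x) (starWedgeStar Ω τ x) +
        a (signedDist Ω x) • extDeriv (starWedgeStar Ω τ) x +
        (a (signedDist Ω x) • wedge (fderiv ℝ (signedDist Ω) x) (codiff τ x) +
        f (signedDist Ω x) • extDeriv (codiff τ) x)) := by
    rw [hcod.extDeriv_eq, extDeriv_fun_add (hd (h1.add h2) hx) (hd (h3.add h4) hx),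
      extDeriv_fun_add (hd h1 hx) (hd h2 hx), extDeriv_fun_add (hd h3 hx) (hd h4 hx),
      extDeriv_comp_signedDist_smul hU hAW hx (haa' _),
      extDeriv_comp_signedDist_smul hU hcW hx (haa _),
      extDeriv_comp_signedDist_smul hU hAT hx (haa _),
      extDeriv_comp_signedDist_smul hU hcT hx (hfa _)]
  rw [htriple] at hext
  have hL : londonOp lam β x = extDeriv (codiff β) x + (lam ^ 2)⁻¹ • β x := rfl
  rw [hL, hext, hβ x hx]
  change _ = ((lam ^ 2)⁻¹ * a (signedDist Ω x) - a'' (signedDist Ω x)) • W x + _ + _ + _ + _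
  change _ + (lam ^ 2)⁻¹ • (a (signedDist Ω x) • W x + f (signedDist Ω x) • τ x) = _
  module

end LondonOperator

/-! ### The `L²` estimates -/

section Estimates

variable {Ω U : Set E3} {ψ : ℝ → ℝ}

theorem exists_forall_abs_le (hψ : Continuous ψ) (hc : HasCompactSupport ψ) :
    ∃ M : ℝ, 0 ≤ M ∧ ∀ r, |ψ r| ≤ M := by
  obtain ⟨M, hM⟩ := hc.exists_bound_of_continuous hψ
  exact ⟨M, (norm_nonneg _).trans (hM 0), hM⟩

theorem exists_forall_norm_le (hb : Bornology.IsBounded Ω) (hne : Ω.Nonempty) {s : ℝ}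
    (hsU : innerCollar Ω s ⊆ U) {η : E3 → Form 2} (hη : ContDiffOn ℝ ∞ η U) :
    ∃ M : ℝ, 0 ≤ M ∧ ∀ x ∈ innerCollar Ω s, ‖η x‖ ≤ M := by
  obtain ⟨M, hM⟩ := (isCompact_innerCollar hb hne s).exists_bound_of_continuousOn
    (hη.continuousOn.mono hsU)
  exact ⟨max M 0, le_max_right _ _, fun x hx => (hM x hx).trans (le_max_left _ _)⟩

theorem norm_smul_le_of_le {c e m N : ℝ} {η : Form 2} (hc : |c| ≤ m * e) (hη : ‖η‖ ≤ N)
    (hm : 0 ≤ m) (he : 0 ≤ e) : ‖c • η‖ ≤ m * N * e := by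
  rw [norm_smul, Real.norm_eq_abs]
  calc |c| * ‖η‖ ≤ (m * e) * N :=
        mul_le_mul hc hη (norm_nonneg _) (mul_nonneg hm he)
    _ = m * N * e := by ring

theorem exists_normL2_beta_le (hΩ : IsOpen Ω) (hb : Bornology.IsBounded Ω) (hne : Ω.Nonempty)
    (hU : IsTubularNhd Ω U) {γ₀ : BoundaryOneForm Ω} (hγ₀ : γ₀.IsSmooth)
    (hψ : ContDiff ℝ ∞ ψ) (hc : HasCompactSupport ψ) {s : ℝ} (hsU : innerCollar Ω s ⊆ U)
    (hs : ∀ r ≤ s, ψ r = 0) :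
    ∃ C : ℝ, ∀ lam : ℝ, 0 < lam →
      normL2 Ω (beta Ω ψ γ₀ lam) ≤ ENNReal.ofReal (C * Real.sqrt lam) := by
  have hγ := contDiffOn_pullback hb hne hU hγ₀
  obtain ⟨M, hM0, hM⟩ := exists_forall_abs_le hψ.continuous hc
  obtain ⟨NW, hNW0, hNW⟩ := exists_forall_norm_le hb hne hsU
    (contDiffOn_wedge (contDiffOn_fderiv_signedDist hU) hγ)
  obtain ⟨NT, hNT0, hNT⟩ := exists_forall_norm_le hb hne hsU (contDiffOn_extDeriv hU.isOpen hγ)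
  obtain ⟨C, hC, hmain⟩ := exists_normL2_le hΩ hb hne hU hsU
  refine ⟨C * (M * NW + M * |s| * NT), fun lam hlam =>
    hmain lam _ _ hlam (by positivity) (fun x hx hxK => ?_) (fun x hx => ?_)⟩
  · have hlt : signedDist Ω x < s := by
      by_contra hcon
      exact hxK ⟨subset_closure hx, not_lt.1 hcon⟩
    exact (eventually_beta_eq_zero hΩ hb hne γ₀ hs lam hx hlt).self_of_nhds
  · rw [beta_eq hb hne hU hγ₀ hψ hc lam (hsU hx), add_mul]
    have he := (Real.exp_pos (signedDist Ω x / lam)).le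
    refine (norm_add_le _ _).trans (add_le_add ?_ ?_)
    · refine norm_smul_le_of_le ?_ (hNW x hx) hM0 he
      rw [abs_mul, Real.abs_exp, mul_comm]
      exact mul_le_mul_of_nonneg_right (hM _) he
    · exact norm_smul_le_of_le (abs_expPrimitive_le hψ.continuous hc hM hs hlam
        (signedDist_nonpos hb hne hx.1)) (hNT x hx) (by positivity) he

theorem exists_normL2_londonOp_le (hΩ : IsOpen Ω) (hb : Bornology.IsBounded Ω) (hne : Ω.Nonempty)
    (hU : IsTubularNhd Ω U) {γ₀ : BoundaryOneForm Ω} (hγ₀ : γ₀.IsSmooth)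
    (hψ : ContDiff ℝ ∞ ψ) (hc : HasCompactSupport ψ) {s : ℝ} (hsU : innerCollar Ω s ⊆ U)
    (hs : ∀ r ≤ s, ψ r = 0) {lam₀ : ℝ} (hlam₀ : 0 < lam₀) :
    ∃ C : ℝ, ∀ lam : ℝ, 0 < lam → lam ≤ lam₀ →
      normL2 Ω (londonOp lam (beta Ω ψ γ₀ lam)) ≤ ENNReal.ofReal (C / Real.sqrt lam) := by
  have hγ := contDiffOn_pullback hb hne hU hγ₀
  have hτ := contDiffOn_extDeriv hU.isOpen hγ
  have hψ1 : ContDiff ℝ ∞ (deriv ψ) := (contDiff_infty_iff_deriv.1 hψ).2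
  have hψ2 : ContDiff ℝ ∞ (deriv (deriv ψ)) := (contDiff_infty_iff_deriv.1 hψ1).2
  have hdψ : ∀ r, HasDerivAt ψ (deriv ψ r) r := fun r =>
    ((contDiff_infty_iff_deriv.1 hψ).1 r).hasDerivAt
  have hdψ1 : ∀ r, HasDerivAt (deriv ψ) (deriv (deriv ψ) r) r := fun r =>
    ((contDiff_infty_iff_deriv.1 hψ1).1 r).hasDerivAt
  obtain ⟨M, hM0, hM⟩ := exists_forall_abs_le hψ.continuous hc
  obtain ⟨M1, hM10, hM1⟩ := exists_forall_abs_le hψ1.continuous hc.deriv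
  obtain ⟨M2, hM20, hM2⟩ := exists_forall_abs_le hψ2.continuous hc.deriv.deriv
  obtain ⟨P, Q, R, hP, hQ, hR, hlondon⟩ := exists_londonOp_eq hΩ hb hne hU hγ hτ
  obtain ⟨NW, hNW0, hNW⟩ := exists_forall_norm_le hb hne hsU
    (contDiffOn_wedge (contDiffOn_fderiv_signedDist hU) hγ)
  obtain ⟨NT, hNT0, hNT⟩ := exists_forall_norm_le hb hne hsU hτ
  obtain ⟨NP, hNP0, hNP⟩ := exists_forall_norm_le hb hne hsU hP
  obtain ⟨NQ, hNQ0, hNQ⟩ := exists_forall_norm_le hb hne hsU hQ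
  obtain ⟨NR, hNR0, hNR⟩ := exists_forall_norm_le hb hne hsU hR
  obtain ⟨C, hC, hmain⟩ := exists_normL2_le hΩ hb hne hU hsU
  set B : ℝ := (2 * M1 + lam₀ * M2) * NW + (M + lam₀ * M1) * NP + lam₀ * M * NQ +
    lam₀ * (M * |s|) * NR + M * NT with hB
  have hB0 : 0 ≤ B := by positivity
  refine ⟨C * B, fun lam hlam hle => ?_⟩
  have hfin := hmain lam (lam⁻¹ * B) (londonOp lam (beta Ω ψ γ₀ lam)) hlam (by positivity)
    (fun x hx hxK => ?_) (fun x hx => ?_)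
  · refine hfin.trans (le_of_eq ?_)
    congr 1
    have h1 := Real.mul_self_sqrt hlam.le
    have h2 := (Real.sqrt_pos.2 hlam).ne'
    have h3 : lam⁻¹ = (Real.sqrt lam)⁻¹ * (Real.sqrt lam)⁻¹ := by rw [← mul_inv, h1]
    rw [h3, div_eq_mul_inv]
    field_simp
  · have hlt : signedDist Ω x < s := by
      by_contra hcon
      exact hxK ⟨subset_closure hx, not_lt.1 hcon⟩
    exact londonOp_eq_zero (eventually_beta_eq_zero hΩ hb hne γ₀ hs lam hx hlt)
  · have hdexp : ∀ r : ℝ, HasDerivAt (fun t => Real.exp (t / lam)) (Real.exp (r / lam) * lam⁻¹) r :=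
      fun r => by simpa [div_eq_mul_inv] using ((hasDerivAt_id r).div_const lam).exp
    have ha : ∀ r, HasDerivAt (fun t => Real.exp (t / lam) * ψ t)
        (Real.exp (r / lam) * (lam⁻¹ * ψ r + deriv ψ r)) r := fun r =>
      ((hdexp r).mul (hdψ r)).congr_deriv (by ring)
    have ha' : ∀ r, HasDerivAt (fun t => Real.exp (t / lam) * (lam⁻¹ * ψ t + deriv ψ t))
        (Real.exp (r / lam) * ((lam ^ 2)⁻¹ * ψ r + 2 * lam⁻¹ * deriv ψ r + deriv (deriv ψ) r)) r :=
      fun r => ((hdexp r).mul (((hdψ r).const_mul lam⁻¹).add (hdψ1 r))).congr_deriv (by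
        simp only [Pi.add_apply]; rw [sq, mul_inv]; ring)
    have ha's : ContDiff ℝ ∞ fun t => Real.exp (t / lam) * (lam⁻¹ * ψ t + deriv ψ t) :=
      contDiff_exp_mul ((contDiff_const.mul hψ).add hψ1) lam
    rw [hlondon lam _ _ _ _ (contDiff_expPrimitive hψ hc lam) (contDiff_exp_mul hψ lam) ha's
      (hasDerivAt_expPrimitive hψ.continuous hc lam) ha ha' _
      (fun y hy => beta_eq hb hne hU hγ₀ hψ hc lam hy) x (hsU hx)]
    set r := signedDist Ω x with hr
    have hr0 : r ≤ 0 := signedDist_nonpos hb hne hx.1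
    set e := Real.exp (r / lam) with hedef
    have he : 0 ≤ e := (Real.exp_pos _).le
    have hinv : 0 < lam⁻¹ := inv_pos.2 hlam
    -- every constant is absorbed into `λ⁻¹` through `1 ≤ λ⁻¹ λ₀`
    have hone : 1 ≤ lam⁻¹ * lam₀ := by
      rw [← inv_mul_cancel₀ hlam.ne']
      exact mul_le_mul_of_nonneg_left hle hinv.le
    have habs : ∀ c m : ℝ, |c| ≤ m → |e * c| ≤ m * e := fun c m h => by
      rw [abs_mul, abs_of_nonneg he, mul_comm]
      exact mul_le_mul_of_nonneg_right h he
    have b1 : |(lam ^ 2)⁻¹ * (e * ψ r) -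
        e * ((lam ^ 2)⁻¹ * ψ r + 2 * lam⁻¹ * deriv ψ r + deriv (deriv ψ) r)| ≤
        lam⁻¹ * (2 * M1 + lam₀ * M2) * e := by
      rw [show (lam ^ 2)⁻¹ * (e * ψ r) -
        e * ((lam ^ 2)⁻¹ * ψ r + 2 * lam⁻¹ * deriv ψ r + deriv (deriv ψ) r) =
        e * (-(2 * lam⁻¹ * deriv ψ r + deriv (deriv ψ) r)) by ring]
      refine habs _ _ ?_
      rw [abs_neg]
      refine (abs_add_le _ _).trans ?_
      rw [abs_mul, abs_of_pos (by positivity : 0 < 2 * lam⁻¹)]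
      nlinarith [mul_le_mul_of_nonneg_left (hM1 r) hinv.le, hM2 r,
        mul_le_mul_of_nonneg_right hone hM20]
    have b2 : |e * (lam⁻¹ * ψ r + deriv ψ r)| ≤ lam⁻¹ * (M + lam₀ * M1) * e := by
      refine habs _ _ ((abs_add_le _ _).trans ?_)
      rw [abs_mul, abs_of_pos hinv]
      nlinarith [mul_le_mul_of_nonneg_left (hM r) hinv.le, hM1 r,
        mul_le_mul_of_nonneg_right hone hM10]
    have b3 : |e * ψ r| ≤ lam⁻¹ * (lam₀ * M) * e := by
      refine habs _ _ ((hM r).trans ?_)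
      nlinarith [mul_le_mul_of_nonneg_right hone hM0]
    have b4 : |expPrimitive ψ lam r| ≤ lam⁻¹ * (lam₀ * (M * |s|)) * e := by
      refine (abs_expPrimitive_le hψ.continuous hc hM hs hlam hr0).trans ?_
      refine mul_le_mul_of_nonneg_right ?_ he
      have h0 : 0 ≤ M * |s| := by positivity
      nlinarith [mul_le_mul_of_nonneg_right hone h0]
    have b5 : |(lam ^ 2)⁻¹ * expPrimitive ψ lam r| ≤ lam⁻¹ * M * e := by
      rw [abs_mul, abs_of_pos (by positivity : 0 < (lam ^ 2)⁻¹)]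
      refine (mul_le_mul_of_nonneg_left (abs_expPrimitive_le_mul hM hlam r)
        (by positivity : 0 ≤ (lam ^ 2)⁻¹)).trans (le_of_eq ?_)
      rw [← hedef]
      field_simp
    have t1 := norm_smul_le_of_le b1 (hNW x hx) (by positivity) he
    have t2 := norm_smul_le_of_le b2 (hNP x hx) (by positivity) he
    have t3 := norm_smul_le_of_le b3 (hNQ x hx) (by positivity) he
    have t4 := norm_smul_le_of_le b4 (hNR x hx) (by positivity) he
    have t5 := norm_smul_le_of_le b5 (hNT x hx) (by positivity) he
    refine (norm_add_le_of_le (norm_add_le_of_le (norm_add_le_of_le (norm_add_le_of_le t1 t2) t3)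
      t4) t5).trans (le_of_eq ?_)
    rw [hB]
    ring

end Estimates

/-! ### Sobolev norms on the boundary -/

section Sobolev

theorem fourier_const_mul (c : ℂ) (u : E2 → ℂ) (ξ : E2) :
    𝓕 (fun y => c * u y) ξ = c * 𝓕 u ξ := by
  simp only [Real.fourier_eq]
  rw [← integral_const_mul]
  congr 1
  funext y
  rw [mul_smul_comm]

theorem sobolevSqPlane_const_mul (s c : ℝ) (u : E2 → ℂ) :
    sobolevSqPlane s (fun y => (c : ℂ) * u y) = ENNReal.ofReal (c ^ 2) * sobolevSqPlane s u := by
  rw [sobolevSqPlane, sobolevSqPlane, ← lintegral_const_mul' _ _ ENNReal.ofReal_ne_top]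
  congr 1
  funext ξ
  rw [fourier_const_mul, ← ENNReal.ofReal_mul (sq_nonneg c), norm_mul, Complex.norm_real,
    Real.norm_eq_abs, mul_pow, sq_abs]
  congr 1
  ring

/-- Test functions belong to every Sobolev space: their Fourier transform is a Schwartz
function. -/
theorem sobolevSqPlane_lt_top (s : ℝ) {u : E2 → ℂ} (hu : ContDiff ℝ ∞ u)
    (hc : HasCompactSupport u) : sobolevSqPlane s u < ⊤ := by
  let f : SchwartzMap E2 ℂ := hc.toSchwartzMap hu
  let m : E2 → ℝ := fun ξ => (1 + ‖ξ‖ ^ 2) ^ (s / 2)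
  have hm : m.HasTemperateGrowth := Function.hasTemperateGrowth_one_add_norm_sq_rpow E2 (s / 2)
  let g : SchwartzMap E2 ℂ := SchwartzMap.smulLeftCLM ℂ m (𝓕 f)
  have hg := lintegral_rpow_enorm_lt_top_of_eLpNorm_lt_top two_ne_zero ENNReal.ofNat_ne_top
    (g.memLp 2 volume).2
  refine lt_of_eq_of_lt ?_ hg
  rw [sobolevSqPlane]
  congr 1
  funext ξ
  have hgξ : g ξ = m ξ • 𝓕 u ξ := SchwartzMap.smulLeftCLM_apply_apply hm _ _
  have hpos : 0 ≤ 1 + ‖ξ‖ ^ 2 := by positivity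
  have hm2 : m ξ ^ 2 = (1 + ‖ξ‖ ^ 2) ^ s := by
    rw [← Real.rpow_natCast, ← Real.rpow_mul hpos]
    congr 1
    push_cast
    ring
  rw [hgξ, ENNReal.toReal_ofNat, ENNReal.rpow_two, ← ofReal_norm, ← ENNReal.ofReal_pow
    (norm_nonneg _), norm_smul, mul_pow, Real.norm_eq_abs, sq_abs, hm2]

variable {Ω U : Set E3}

theorem localCoeff_const_smul (A : BoundaryAtlas Ω) (c : ℝ) (τ : BoundaryTwoForm Ω)
    (j : Fin A.card) :
    A.localCoeff (fun p => c • τ p) j = fun y => (c : ℂ) * A.localCoeff τ j y := by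
  funext y
  simp only [BoundaryAtlas.localCoeff]
  split_ifs
  · rw [ContinuousAlternatingMap.smul_apply, smul_eq_mul]
    push_cast
    ring
  · rw [mul_zero]

theorem sobolevNorm_const_smul (A : BoundaryAtlas Ω) (s c : ℝ) (τ : BoundaryTwoForm Ω) :
    A.sobolevNorm s (fun p => c • τ p) = ENNReal.ofReal |c| * A.sobolevNorm s τ := by
  simp only [BoundaryAtlas.sobolevNorm, localCoeff_const_smul, sobolevSqPlane_const_mul]
  rw [← Finset.mul_sum, ENNReal.mul_rpow_of_nonneg _ _ (by norm_num),
    ENNReal.ofReal_rpow_of_nonneg (sq_nonneg c) (by norm_num), ← Real.sqrt_eq_rpow,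
    Real.sqrt_sq_eq_abs]

/-- In a chart, the localized coefficient of the restriction of a smooth 2-form is a test
function: it vanishes off the image, under the inverse chart, of the support of the cutoff. -/
theorem contDiff_localCoeff_restrictTwo (hb : Bornology.IsBounded Ω) (hne : Ω.Nonempty)
    (hU : IsTubularNhd Ω U) (A : BoundaryAtlas Ω) {η : E3 → Form 2} (hη : ContDiffOn ℝ ∞ η U)
    (j : Fin A.card) :
    ContDiff ℝ ∞ (A.localCoeff (restrictTwo Ω η) j) ∧
      HasCompactSupport (A.localCoeff (restrictTwo Ω η) j) := by
  set χ := A.chart j with hχ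
  set c : E2 → E3 := fun z => (χ z : E3) with hcdef
  have hopen : IsOpen χ.source := χ.open_source
  have hc : ContDiffOn ℝ ∞ c χ.source := A.contDiffOn_chart j
  have hcU : MapsTo c χ.source U := fun y _ => hU.frontier_subset (χ y).2
  have hdc : ContDiffOn ℝ ∞ (fderiv ℝ c) χ.source := hc.fderiv_of_isOpen hopen (by simp)
  have hcoord : ∀ (i : Fin 2) (k : Fin 3),
      ContDiffOn ℝ ∞ (fun y => fderiv ℝ c y (EuclideanSpace.single i 1) k) χ.source := fun i k =>
    (EuclideanSpace.proj k : E3 →L[ℝ] ℝ).contDiff.comp_contDiffOn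
      (hdc.clm_apply contDiffOn_const)
  have hcoef : ∀ k : Fin 3, ContDiffOn ℝ ∞ (fun y => twoCoeff (η (c y)) k) χ.source := fun k =>
    (twoCoeffCLM k).contDiff.comp_contDiffOn (hη.comp hc hcU)
  have hcut : ContDiffOn ℝ ∞ (fun y => A.cutoff j (c y)) χ.source :=
    (A.contDiff_cutoff j).comp_contDiffOn hc
  have hval : ∀ y ∈ χ.source, A.localCoeff (restrictTwo Ω η) j y =
      ((A.cutoff j (c y) *
        η (c y) (fun i => fderiv ℝ c y (EuclideanSpace.single i 1)) : ℝ) : ℂ) := by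
    intro y hy
    have hmem : ∀ v, fderiv ℝ c y v ∈ tangentPlane Ω (c y) :=
      fderiv_mem_tangentPlane hb hne hU
        ((hc.contDiffAt (hopen.mem_nhds hy)).differentiableAt (by simp))
        (Filter.Eventually.of_forall fun z => (χ z).2)
    rw [BoundaryAtlas.localCoeff, if_pos hy]
    congr 2
    change η (c y) (fun i => ((tangentProj Ω (c y) (fderiv ℝ c y (EuclideanSpace.single i 1)) :
      tangentPlane Ω (c y)) : E3)) = _
    congr 1
    funext i
    rw [tangentProj_of_mem (hmem _)]
  have hsmooth : ContDiffOn ℝ ∞ (A.localCoeff (restrictTwo Ω η) j) χ.source := by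
    refine ContDiffOn.congr ?_ hval
    refine Complex.ofRealCLM.contDiff.comp_contDiffOn (hcut.mul ?_)
    simp only [form_two_apply]
    exact (((hcoef 0).mul (((hcoord 0 1).mul (hcoord 1 2)).sub ((hcoord 0 2).mul (hcoord 1 1)))).add
      ((hcoef 1).mul (((hcoord 0 2).mul (hcoord 1 0)).sub ((hcoord 0 0).mul (hcoord 1 2))))).add
      ((hcoef 2).mul (((hcoord 0 0).mul (hcoord 1 1)).sub ((hcoord 0 1).mul (hcoord 1 0))))
  have : CompactSpace (frontier Ω) := isCompact_iff_compactSpace.1 (isCompact_frontier hb)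
  set T : Set (frontier Ω) := {p | (p : E3) ∈ tsupport (A.cutoff j)} with hT
  have hTc : IsCompact T :=
    ((isClosed_tsupport (A.cutoff j)).preimage continuous_subtype_val).isCompact
  have hTt : T ⊆ χ.target := fun p hp => A.cutoff_support j p hp
  set K : Set E2 := χ.symm '' T with hK
  have hKc : IsCompact K := hTc.image_of_continuousOn (χ.continuousOn_symm.mono hTt)
  have hKs : K ⊆ χ.source := by
    rintro _ ⟨p, hp, rfl⟩
    exact χ.map_target (hTt hp)
  have hzero : ∀ y, y ∉ K → A.localCoeff (restrictTwo Ω η) j y = 0 := by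
    intro y hy
    by_cases hys : y ∈ χ.source
    · have hnot : c y ∉ tsupport (A.cutoff j) := fun h =>
        hy ⟨χ y, h, χ.left_inv hys⟩
      rw [hval y hys, image_eq_zero_of_notMem_tsupport hnot]
      simp
    · rw [BoundaryAtlas.localCoeff, if_neg hys]
  refine ⟨contDiff_iff_contDiffAt.2 fun y => ?_, HasCompactSupport.intro hKc hzero⟩
  by_cases hys : y ∈ χ.source
  · exact hsmooth.contDiffAt (hopen.mem_nhds hys)
  · have hyK : y ∈ Kᶜ := fun h => hys (hKs h)
    refine (contDiffAt_const (c := (0 : ℂ))).congr_of_eventuallyEq ?_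
    filter_upwards [hKc.isClosed.isOpen_compl.mem_nhds hyK] with z hz using hzero z hz

theorem sobolevNorm_restrictTwo_lt_top (hb : Bornology.IsBounded Ω) (hne : Ω.Nonempty)
    (hU : IsTubularNhd Ω U) (A : BoundaryAtlas Ω) {η : E3 → Form 2} (hη : ContDiffOn ℝ ∞ η U)
    (s : ℝ) : A.sobolevNorm s (restrictTwo Ω η) < ⊤ := by
  refine ENNReal.rpow_lt_top_of_nonneg (y := 1 / 2) (by norm_num)
    (ENNReal.sum_lt_top.2 fun j _ => ?_).ne
  obtain ⟨h1, h2⟩ := contDiff_localCoeff_restrictTwo hb hne hU A hη j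
  exact sobolevSqPlane_lt_top s h1 h2

theorem exists_sobolevNorm_beta_le (hb : Bornology.IsBounded Ω) (hne : Ω.Nonempty)
    (hU : IsTubularNhd Ω U) {γ₀ : BoundaryOneForm Ω} (hγ₀ : γ₀.IsSmooth) {ψ : ℝ → ℝ}
    (hψ : ContDiff ℝ ∞ ψ) (hc : HasCompactSupport ψ) (A : BoundaryAtlas Ω) (s : ℝ) :
    ∃ C : ℝ, ∀ lam : ℝ, 0 < lam →
      A.sobolevNorm s (restrictTwo Ω (beta Ω ψ γ₀ lam)) ≤ ENNReal.ofReal (C * lam) := by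
  obtain ⟨M, hM0, hM⟩ := exists_forall_abs_le hψ.continuous hc
  have hfin := sobolevNorm_restrictTwo_lt_top hb hne hU A
    (contDiffOn_extDeriv hU.isOpen (contDiffOn_pullback hb hne hU hγ₀)) s
  refine ⟨M * (A.sobolevNorm s (restrictTwo Ω (extDeriv (pullback Ω γ₀)))).toReal,
    fun lam hlam => ?_⟩
  rw [restrictTwo_beta hb hne hU hγ₀ hψ hc, sobolevNorm_const_smul, mul_right_comm,
    ENNReal.ofReal_mul (by positivity), ENNReal.ofReal_toReal hfin.ne]
  refine mul_le_mul_left (ENNReal.ofReal_le_ofReal ?_) _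
  simpa using abs_expPrimitive_le_mul hM hlam 0

end Sobolev

end London

end

theorem mainTheorem11
    (Ω : Set London.E3) (hΩ_open : IsOpen Ω) (hΩ_bdd : Bornology.IsBounded Ω)
    (hΩ_ne : Ω.Nonempty) (hΩ_smooth : London.HasSmoothBoundary Ω)
    (U : Set London.E3) (hU : London.IsTubularNhd Ω U)
    (r₀ : ℝ) (hr₀ : 0 < r₀) (hV : London.collar Ω r₀ ⊆ U)
    (ψ : ℝ → ℝ) (hψ_smooth : ContDiff ℝ ∞ ψ)
    (hψ_supp : tsupport ψ ⊆ Set.Ioo (-(2 * r₀)) (2 * r₀))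
    (hψ_one : ∀ r : ℝ, |r| ≤ r₀ → ψ r = 1)
    (γ₀ : London.BoundaryOneForm Ω) (hγ₀ : γ₀.IsSmooth) :
    -- compact support in the collar, within the closure of the domain
    (∃ K : Set London.E3, IsCompact K ∧ K ⊆ London.collar Ω r₀ ∧
      (∀ x ∈ K, -(2 * r₀) < London.signedDist Ω x) ∧
      ∀ lam : ℝ, 0 < lam → ∀ x ∈ closure Ω, x ∉ K → London.beta Ω ψ γ₀ lam x = 0) ∧
    (∀ lam : ℝ, 0 < lam →
      -- smoothness on an open set containing the closure of the domain
      ContDiffOn ℝ ∞ (London.beta Ω ψ γ₀ lam) (Ω ∪ U) ∧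
      -- the explicit formula
      (∀ x ∈ U, London.beta Ω ψ γ₀ lam x =
        (Real.exp (London.signedDist Ω x / lam) * ψ (London.signedDist Ω x)) •
            London.wedge (fderiv ℝ (London.signedDist Ω) x) (London.pullback Ω γ₀ x) +
          London.expPrimitive ψ lam (London.signedDist Ω x) •
            extDeriv (London.pullback Ω γ₀) x) ∧
      -- closedness
      (∀ x ∈ closure Ω, extDeriv (London.beta Ω ψ γ₀ lam) x = 0) ∧
      -- tangential boundary data
      London.restrictOne Ω (fun x => London.star (London.beta Ω ψ γ₀ lam x)) =
        London.starBoundary Ω γ₀) ∧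
    -- estimates
    (∃ C : ℝ, ∀ lam : ℝ, 0 < lam →
      London.normL2 Ω (London.beta Ω ψ γ₀ lam) ≤ ENNReal.ofReal (C * Real.sqrt lam)) ∧
    (∀ lam₀ : ℝ, 0 < lam₀ → ∃ C : ℝ, ∀ lam : ℝ, 0 < lam → lam ≤ lam₀ →
      London.normL2 Ω (London.londonOp lam (London.beta Ω ψ γ₀ lam)) ≤
        ENNReal.ofReal (C / Real.sqrt lam)) ∧
    (∀ (A : London.BoundaryAtlas Ω) (s : ℝ), ∃ C : ℝ, ∀ lam : ℝ, 0 < lam →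
      A.sobolevNorm s (London.restrictTwo Ω (London.beta Ω ψ γ₀ lam)) ≤
        ENNReal.ofReal (C * lam)) := by
  have hc := London.hasCompactSupport_of_tsupport_subset_Ioo hψ_supp
  obtain ⟨s, hsr, hs⟩ := London.exists_forall_le_eq_zero (by linarith) hψ_supp
  have hKV : London.innerCollar Ω s ⊆ London.collar Ω r₀ :=
    London.innerCollar_subset_collar hΩ_bdd hΩ_ne hsr.le
  have hsU : London.innerCollar Ω s ⊆ U := hKV.trans hV
  have hβ : ∀ (lam : ℝ), ∀ x ∈ Ω ∪ U, ContDiffAt ℝ ∞ (London.beta Ω ψ γ₀ lam) x ∧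
      extDeriv (London.beta Ω ψ γ₀ lam) x = 0 := fun lam x hx =>
    London.contDiffAt_beta hΩ_open hΩ_bdd hΩ_ne hU hγ₀ hψ_smooth hc hV hs hsr lam hx
  refine ⟨⟨London.innerCollar Ω s, London.isCompact_innerCollar hΩ_bdd hΩ_ne s, hKV,
      fun x hx => hsr.trans_le hx.2, fun lam _ x hx hxK => ?_⟩, fun lam _ => ⟨fun x hx =>
      (hβ lam x hx).1.contDiffWithinAt,
      fun x hx => London.beta_eq hΩ_bdd hΩ_ne hU hγ₀ hψ_smooth hc lam hx,
      fun x hx => (hβ lam x (London.closure_subset_union hU hx)).2,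
      London.restrictOne_star_beta hΩ_open hΩ_bdd hΩ_ne hU hγ₀ hψ_smooth hc
        (hψ_one 0 (by simpa using hr₀.le)) lam⟩,
    London.exists_normL2_beta_le hΩ_open hΩ_bdd hΩ_ne hU hγ₀ hψ_smooth hc hsU hs,
    fun lam₀ hlam₀ =>
      London.exists_normL2_londonOp_le hΩ_open hΩ_bdd hΩ_ne hU hγ₀ hψ_smooth hc hsU hs hlam₀,
    fun A σ => London.exists_sobolevNorm_beta_le hΩ_bdd hΩ_ne hU hγ₀ hψ_smooth hc A σ⟩
  have hlt : London.signedDist Ω x < s := by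
    by_contra hcon
    exact hxK ⟨hx, not_lt.1 hcon⟩
  by_cases hxΩ : x ∈ Ω
  · exact (London.eventually_beta_eq_zero hΩ_open hΩ_bdd hΩ_ne γ₀ hs lam hxΩ hlt).self_of_nhds
  · -- a point of `∂Ω` would give `0 = ρ(x) < s` and hence `ψ(0) = 0`
    have h0 := London.signedDist_of_mem_frontier hΩ_bdd hΩ_ne
      ⟨hx, fun h => hxΩ (interior_subset h)⟩
    have h1 := hs 0 (h0 ▸ hlt).le
    rw [hψ_one 0 (by simpa using hr₀.le)] at h1
    exact absurd h1 one_ne_zero
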